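/- **Setting.** Let $R$ be a ring and let $\mathcal E$ be a full, additive, extension-closed subcategory of the category of $R$-modules, regarded as an exact category through the short exact sequences of $R$-modules with all terms in $\mathcal E$. Let $(\mathcal A,\mathcal B)$ be a complete hereditary cotorsion pair in $\mathcal E$; that is, $\mathcal A,\mathcal B\subseteq\mathcal E$ and * $\mathcal A=\{X\in\mathcal E:\operatorname{Ext}^1_R(X,B)=0\ \forall B\in\mathcal B\}$ and $\mathcal B=\{Y\in\mathcal E:\operatorname{Ext}^1_R(A,Y)=0\ \forall A\in\mathcal A\}$ (cotorsion pair); * $\operatorname{Ext}^i_R(A,B)=0$ for all $i>0$, $A\in\mathcal A$, $B\in\mathcal B$ (hereditary); * for every $M\in\mathcal E$ there are short exact sequences $0\to B\to A\to M\to 0$ and $0\to M\to B'\to A'\to 0$ with $A,A'\in\mathcal A$ and $B,B'\in\mathcal B$ (complete). Let $\mathcal C$ be a class with $\mathcal A\subseteq\mathcal C\subseteq\mathcal E$, closed under extensions and under kernels of admissible epimorphisms of $\mathcal E$ (if $0\to X\to Y\to Z\to 0$ is short exact with terms in $\mathcal E$ and $Y,Z\in\mathcal C$, then $X\in\mathcal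 C$). Let $\mathcal D$ be a class with $\mathcal B\subseteq\mathcal D\subseteq\mathcal E$, closed under extensions and, dually, under cokernels of admissible monomorphisms of $\mathcal E$. Assume that the exact categories $\mathcal A\cap\mathcal D$, $\mathcal C\cap\mathcal D$ and $\mathcal C\cap\mathcal B$ (with the short exact sequences having all terms in the class) are Frobenius categories, each with class of projective-injective objects equal to $\mathcal A\cap\mathcal B$. For a Frobenius category $\mathcal F$ let $\underline{\mathcal F}$ be its stable category (same objects; morphisms modulo those that factor through a projective-injective object), with Happel's triangulated structure. **Functors.** Let $i_*:\underline{\mathcal A\cap\mathcal D}\to\underline{\mathcal C\cap\mathcal D}$ and $j_*:\underline{\mathcal C\cap\mathcal B}\to\underline{\mathcal C\cap\mathcal D}$ be the functors induced by the inclusions. For every $M\in\mathcal C\cap\mathcal D$ choose short exact sequences $$0\to B_M\to A_M\xrightarrow{p_M}M\to0,\qquad 0\to M\xrightarrow{\iota_M}B'_M\to A'_M\to0$$ with $A_M,A'_M\in\mathcal A$ and $B_M,B'_M\in\mathcal B$. Then $A_M\in\mathcal A\cap\mathcal D$ and $B'_M\in\mathcal C\cap\mathcal B$. The functor $i^!:\underline{\mathcal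 C\cap\mathcal D}\to\underline{\mathcal A\cap\mathcal D}$ is given by $M\mapsto A_M$ and $[f]\mapsto[g]$, where $g:A_M\to A_{M'}$ is any map with $p_{M'}g=fp_M$. The functor $j^*:\underline{\mathcal C\cap\mathcal D}\to\underline{\mathcal C\cap\mathcal B}$ is given by $M\mapsto B'_M$ and $[f]\mapsto[g]$, where $g:B'_M\to B'_{M'}$ is any map with $g\iota_M=\iota_{M'}f$. (Both are well defined.) **Theorem.** The functors $i_*$, $i^!$, $j^*$, $j_*$ are triangulated, and $$\underline{\mathcal A\cap\mathcal D}\xrightarrow{\;i_*\;}\underline{\mathcal C\cap\mathcal D}\xrightarrow{\;j^*\;}\underline{\mathcal C\cap\mathcal B}$$ is a localization sequence of triangulated categories. In detail: * $i^!$ is right adjoint to $i_*$ with counit $[p_M]:i_*i^!M\to M$, and $j_*$ is right adjoint to $j^*$ with unit $[\iota_M]:M\to j_*j^*M$; both adjunctions are compatible with the triangulated structures; * the unit $\mathrm{id}\to i^!i_*$ and the counit $j^*j_*\to\mathrm{id}$ are isomorphisms; * for $M\in\mathcal C\cap\mathcal D$, $j^*M=0$ in $\underline{\mathcal C\cap\mathcal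 B}$ if and only if $M$ is isomorphic in $\underline{\mathcal C\cap\mathcal D}$ to $i_*N$ for some $N\in\mathcal A\cap\mathcal D$. Consequently, the essential image of $i_*$ is a triangulated subcategory of $\underline{\mathcal C\cap\mathcal D}$, and $j^*$ induces an equivalence of triangulated categories from the Verdier quotient $$\underline{\mathcal C\cap\mathcal D}\,/\,\underline{\mathcal A\cap\mathcal D}\;\xrightarrow{\ \sim\ }\;\underline{\mathcal C\cap\mathcal B},$$ that is, there is a triangulated equivalence $\Phi$ out of the quotient and an isomorphism of triangulated functors $\Phi\circ Q\cong j^*$, where $Q$ is the quotient functor. -/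

import Mathlib

open CategoryTheory Category Limits

/-! ### The shift by `ℤ` attached to an autoequivalence -/

namespace AutoShift

universe v u

variable {C : Type u} [Category.{v} C]

/-- Sequences `(X n)` indexed by `ℤ` with isomorphisms `T (X n) ≅ X (n + 1)`. -/
structure Orbit (T : C ⥤ C) where
  X : ℤ → C
  iso : ∀ n m : ℤ, n + 1 = m → (T.obj (X n) ≅ X m)

namespace Orbit

variable {T : C ⥤ C}

/-- Morphisms of sequences. -/
@[ext]
structure Hom (A B : Orbit T) where
  f : ∀ n, A.X n ⟶ B.X n
  comm : ∀ n m h, T.map (f n) ≫ (B.iso n m h).hom = (A.iso n m h).hom ≫ f m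

instance : Category (Orbit T) where
  Hom := Hom
  id A := { f := fun _ => 𝟙 _, comm := by simp }
  comp φ ψ := { f := fun n => φ.f n ≫ ψ.f n, comm := by
                  intro n m h
                  rw [T.map_comp, assoc, ψ.comm, ← assoc, φ.comm, assoc] }

@[ext]
lemma hom_ext {A B : Orbit T} {φ ψ : A ⟶ B} (h : ∀ n, φ.f n = ψ.f n) : φ = ψ :=
  Hom.ext (funext h)

@[simp] lemma id_f (A : Orbit T) (n : ℤ) : Hom.f (𝟙 A) n = 𝟙 _ := rfl
@[simp] lemma comp_f {A B D : Orbit T} (φ : A ⟶ B) (ψ : B ⟶ D) (n : ℤ) :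
    (φ ≫ ψ).f n = φ.f n ≫ ψ.f n := rfl

lemma eqToHom_comm (A : Orbit T) (n m n' m' : ℤ) (h : n + 1 = m) (h' : n' + 1 = m')
    (e : n = n') :
    T.map (eqToHom (congrArg A.X e)) ≫ (A.iso n' m' h').hom =
      (A.iso n m h).hom ≫ eqToHom (congrArg A.X (by omega)) := by
  subst e
  subst h
  subst h'
  simp

lemma f_eqToHom {A B : Orbit T} (φ : A ⟶ B) (n n' : ℤ) (e : n = n') :
    φ.f n ≫ eqToHom (congrArg B.X e) = eqToHom (congrArg A.X e) ≫ φ.f n' := by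
  subst e
  simp

variable (T)

/-- Reindexing of sequences. -/
def reindex (k : ℤ) : Orbit T ⥤ Orbit T where
  obj A := { X := fun n => A.X (n + k), iso := fun n m h => A.iso (n + k) (m + k) (by omega) }
  map φ := { f := fun n => φ.f (n + k), comm := fun n m h => φ.comm _ _ _ }

@[simp] lemma reindex_obj_X (k : ℤ) (A : Orbit T) (n : ℤ) :
    ((reindex T k).obj A).X n = A.X (n + k) := rfl

@[simp] lemma reindex_map_f (k : ℤ) {A B : Orbit T} (φ : A ⟶ B) (n : ℤ) :
    ((reindex T k).map φ).f n = φ.f (n + k) := rfl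

/-- Reindexing by zero. -/
def reindexZero : reindex T 0 ≅ 𝟭 (Orbit T) :=
  NatIso.ofComponents (fun A =>
    { hom := { f := fun n => eqToHom (congrArg A.X (add_zero n)),
               comm := fun n m h => A.eqToHom_comm _ _ _ _ _ _ (add_zero n) }
      inv := { f := fun n => eqToHom (congrArg A.X (add_zero n).symm),
               comm := fun n m h => A.eqToHom_comm _ _ _ _ _ _ (add_zero n).symm }
      hom_inv_id := by
        ext n
        exact eqToHom_trans (congrArg A.X (add_zero n)) (congrArg A.X (add_zero n).symm)
      inv_hom_id := by
        ext n
        exact eqToHom_trans (congrArg A.X (add_zero n).symm) (congrArg A.X (add_zero n)) })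
    (fun {A B} φ => by ext n; exact f_eqToHom φ _ _ (add_zero n))

lemma index_add (n a b : ℤ) : n + (a + b) = n + b + a := by omega

/-- Reindexing by a sum. -/
def reindexAdd (a b : ℤ) : reindex T (a + b) ≅ reindex T a ⋙ reindex T b :=
  NatIso.ofComponents (fun A =>
    { hom := { f := fun n => eqToHom (congrArg A.X (index_add n a b)),
               comm := fun n m h => A.eqToHom_comm _ _ _ _ _ _ (index_add n a b) }
      inv := { f := fun n => eqToHom (congrArg A.X (index_add n a b).symm),
               comm := fun n m h => A.eqToHom_comm _ _ _ _ _ _ (index_add n a b).symm }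
      hom_inv_id := by
        ext n
        exact eqToHom_trans (congrArg A.X (index_add n a b))
          (congrArg A.X (index_add n a b).symm)
      inv_hom_id := by
        ext n
        exact eqToHom_trans (congrArg A.X (index_add n a b).symm)
          (congrArg A.X (index_add n a b)) })
    (fun {A B} φ => by ext n; exact f_eqToHom φ _ _ (index_add n a b))

lemma eqToHom_three {a b b' d d' : C} (p : a = b) (q : b = d) (r : a = b') (s : b' = d')
    (t : d' = d) : eqToHom p ≫ eqToHom q = eqToHom r ≫ eqToHom s ≫ eqToHom t := by
  subst p
  subst q
  subst r
  subst s
  simp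

lemma reindexZero_inv_f (A : Orbit T) (n : ℤ) : Hom.f ((reindexZero T).inv.app A) n =
    eqToHom (congrArg A.X (add_zero n).symm) := rfl

lemma reindexAdd_hom_f (a b : ℤ) (A : Orbit T) (n : ℤ) : Hom.f ((reindexAdd T a b).hom.app A) n =
    eqToHom (congrArg A.X (index_add n a b)) := rfl

lemma eqToHom_f {A B : Orbit T} (h : A = B) (n : ℤ) :
    Hom.f (eqToHom h) n = eqToHom (by rw [h]) := by
  subst h
  rfl

/-- The shift on sequences. -/
instance : HasShift (Orbit T) ℤ := hasShiftMk _ _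
  { F := reindex T
    zero := reindexZero T
    add := reindexAdd T
    assoc_hom_app := by
      intro a b c A
      ext n
      rw [comp_f, comp_f, comp_f, eqToHom_f, reindexAdd_hom_f, reindexAdd_hom_f, reindexAdd_hom_f,
        reindex_map_f, reindexAdd_hom_f]
      exact eqToHom_three _ _ _ _ _
    zero_add_hom_app := by
      intro k A
      ext n
      rw [comp_f, eqToHom_f, reindexAdd_hom_f, reindex_map_f, reindexZero_inv_f]
      exact (eqToHom_trans _ _).symm
    add_zero_hom_app := by
      intro k A
      ext n
      rw [comp_f, eqToHom_f, reindexAdd_hom_f, reindexZero_inv_f]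
      exact (eqToHom_trans _ _).symm }

/-- Evaluation at index zero. -/
def ev : Orbit T ⥤ C where
  obj A := A.X 0
  map φ := φ.f 0

variable {T}

section

variable {A B : Orbit T}

variable [T.Full]

/-- Transport of a morphism along one step. -/
noncomputable def up {n m : ℤ} (h : n + 1 = m) (g : A.X n ⟶ B.X n) : A.X m ⟶ B.X m :=
  (A.iso n m h).inv ≫ T.map g ≫ (B.iso n m h).hom

/-- Transport of a morphism back along one step. -/
noncomputable def down {n m : ℤ} (h : n + 1 = m) (g : A.X m ⟶ B.X m) : A.X n ⟶ B.X n :=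
  T.preimage ((A.iso n m h).hom ≫ g ≫ (B.iso n m h).inv)

/-- Nonnegative part of the extension of a morphism. -/
noncomputable def extPos (g : A.X 0 ⟶ B.X 0) : ∀ k : ℕ, A.X (k : ℤ) ⟶ B.X (k : ℤ)
  | 0 => g
  | k + 1 => up (n := (k : ℤ)) (by push_cast; rfl) (extPos g k)

/-- Negative part of the extension of a morphism. -/
noncomputable def extNeg (g : A.X 0 ⟶ B.X 0) :
    ∀ k : ℕ, A.X (Int.negSucc k) ⟶ B.X (Int.negSucc k)
  | 0 => down (m := 0) (by omega) g
  | k + 1 => down (m := Int.negSucc k) (by omega) (extNeg g k)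

/-- Extension of a morphism at index zero. -/
noncomputable def extHom (g : A.X 0 ⟶ B.X 0) : ∀ n : ℤ, A.X n ⟶ B.X n
  | Int.ofNat k => extPos g k
  | Int.negSucc k => extNeg g k

lemma extHom_comm (g : A.X 0 ⟶ B.X 0) (n m : ℤ) (h : n + 1 = m) :
    T.map (extHom g n) ≫ (B.iso n m h).hom = (A.iso n m h).hom ≫ extHom g m := by
  rcases n with k | k
  · obtain rfl : m = Int.ofNat (k + 1) := by rw [← h]; rfl
    simp [extHom, extPos, up]
  · rcases k with _ | k
    · obtain rfl : m = Int.ofNat 0 := by rw [← h]; rfl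
      simp [extHom, extNeg, extPos, down]
    · obtain rfl : m = Int.negSucc k := by rw [← h]; rfl
      simp [extHom, extNeg, down]

instance : (ev T).Full where
  map_surjective g := ⟨{ f := extHom g, comm := extHom_comm g }, rfl⟩

instance [T.Faithful] : (ev T).Faithful where
  map_injective {A B} φ ψ h := by
    have h0 : φ.f 0 = ψ.f 0 := h
    have hup : ∀ n, φ.f n = ψ.f n → φ.f (n + 1) = ψ.f (n + 1) := fun n e => by
      rw [← cancel_epi (A.iso n (n + 1) rfl).hom, ← φ.comm, ← ψ.comm, e]
    have hdown : ∀ n, φ.f (n + 1) = ψ.f (n + 1) → φ.f n = ψ.f n := fun n e => by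
      apply T.map_injective
      rw [← cancel_mono (B.iso n (n + 1) rfl).hom, φ.comm, ψ.comm, e]
    ext n
    induction n using Int.induction_on with
    | zero => exact h0
    | succ k ih => exact hup _ ih
    | pred k ih =>
        apply hdown
        have : -(k : ℤ) - 1 + 1 = -k := by omega
        rw [this]
        exact ih

end

section

variable [T.IsEquivalence]

/-- The sequence of iterates of `T` and of its inverse on an object. -/
noncomputable def seqX (X : C) : ℤ → C
  | Int.ofNat k => Nat.rec X (fun _ Y => T.obj Y) k
  | Int.negSucc k => Nat.rec (T.inv.obj X) (fun _ Y => T.inv.obj Y) k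

/-- The structure isomorphisms of the sequence of iterates. -/
noncomputable def seqIso (X : C) (n : ℤ) : T.obj (seqX (T := T) X n) ≅ seqX (T := T) X (n + 1) :=
  match n with
  | Int.ofNat _ => Iso.refl _
  | Int.negSucc 0 => T.asEquivalence.counitIso.app X
  | Int.negSucc (k + 1) => T.asEquivalence.counitIso.app (seqX (T := T) X (Int.negSucc k))

instance : (ev T).EssSurj where
  mem_essImage X := ⟨⟨seqX X, fun n m h => seqIso X n ≪≫ eqToIso (by rw [h])⟩, ⟨Iso.refl _⟩⟩

instance : (ev T).IsEquivalence where

end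

end Orbit

variable (T : C ⥤ C) [T.IsEquivalence]

/-- The shift functors of the `ℤ`-shift attached to `T`. -/
noncomputable def shiftObj (k : ℤ) : C ⥤ C :=
  (Orbit.ev T).inv ⋙ shiftFunctor (Orbit T) k ⋙ Orbit.ev T

/-- The `ℤ`-shift attached to an autoequivalence `T`. -/
@[reducible]
noncomputable def hasShift : HasShift C ℤ :=
  (Functor.FullyFaithful.ofFullyFaithful (Orbit.ev T).inv).hasShift (shiftObj T)
    (fun k => Functor.isoWhiskerLeft ((Orbit.ev T).inv ⋙ shiftFunctor (Orbit T) k)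
      (Orbit.ev T).asEquivalence.unitIso.symm)

/-- The shift by `1` is `T`. -/
noncomputable def shiftOneIso :
    letI := hasShift T
    shiftFunctor C (1 : ℤ) ≅ T :=
  NatIso.ofComponents (fun X => ((((Orbit.ev T).inv.obj X).iso 0 (0 + 1) rfl).symm ≪≫
    T.mapIso ((Orbit.ev T).asEquivalence.counitIso.app X) :)) (by
      intro X Y f
      have h1 := ((Orbit.ev T).inv.map f).comm 0 (0 + 1) rfl
      have h2 := (Orbit.ev T).asEquivalence.counitIso.hom.naturality f
      have h3 := congrArg T.map h2
      rw [T.map_comp, T.map_comp] at h3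
      change Orbit.Hom.f ((Orbit.ev T).inv.map f) (0 + 1) ≫
        (((Orbit.ev T).inv.obj Y).iso 0 (0 + 1) rfl).inv ≫ T.map _ =
        ((((Orbit.ev T).inv.obj X).iso 0 (0 + 1) rfl).inv ≫ T.map _) ≫ T.map f
      rw [assoc, ← cancel_epi (((Orbit.ev T).inv.obj X).iso 0 (0 + 1) rfl).hom, ← assoc, ← h1,
        assoc, Iso.hom_inv_id_assoc, Iso.hom_inv_id_assoc]
      exact h3)

end AutoShift
set_option linter.unusedSectionVars false

/-! ### Frobenius subcategories of an abelian category and their stable categories -/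

open ZeroObject

namespace Frob

universe v u

variable {𝒜 : Type u} [Category.{v} 𝒜] [Abelian 𝒜]

/-- A conflation of the full subcategory `P`: a short exact sequence whose terms lie in `P`. -/
structure IsConflation (P : ObjectProperty 𝒜) (S : ShortComplex 𝒜) : Prop where
  exact : S.ShortExact
  mem₁ : P S.X₁
  mem₂ : P S.X₂
  mem₃ : P S.X₃

/-- `X` is a projective object of the exact category `P`. -/
structure IsProj (P : ObjectProperty 𝒜) (X : 𝒜) : Prop where
  mem : P X
  lift : ∀ S : ShortComplex 𝒜, IsConflation P S → ∀ f : X ⟶ S.X₃, ∃ g : X ⟶ S.X₂, g ≫ S.g = f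

/-- `X` is an injective object of the exact category `P`. -/
structure IsInj (P : ObjectProperty 𝒜) (X : 𝒜) : Prop where
  mem : P X
  ext : ∀ S : ShortComplex 𝒜, IsConflation P S → ∀ f : S.X₁ ⟶ X, ∃ g : S.X₂ ⟶ X, S.f ≫ g = f

/-- The full subcategory `P` contains zero, is closed under extensions, and is a Frobenius
category for the exact structure given by its conflations. -/
class IsFrobenius (P : ObjectProperty 𝒜) : Prop
    extends P.ContainsZero, P.IsClosedUnderExtensions where
  enough_proj : ∀ X, P X → ∃ (K Q : 𝒜) (i : K ⟶ Q) (p : Q ⟶ X) (w : i ≫ p = 0),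
    IsConflation P (ShortComplex.mk i p w) ∧ IsProj P Q
  enough_inj : ∀ X, P X → ∃ (I Z : 𝒜) (i : X ⟶ I) (p : I ⟶ Z) (w : i ≫ p = 0),
    IsConflation P (ShortComplex.mk i p w) ∧ IsInj P I
  proj_iff_inj : ∀ X, IsProj P X ↔ IsInj P X

section closure

variable (P : ObjectProperty 𝒜) [P.ContainsZero] [P.IsClosedUnderExtensions]

lemma prop_of_isZero {X : 𝒜} (hX : IsZero X) : P X := by
  obtain ⟨Z, hZ, hPZ⟩ := P.exists_prop_of_containsZero
  have e : IsZero X := hX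
  refine P.prop_X₂_of_shortExact (S := ShortComplex.mk (0 : Z ⟶ X) (0 : X ⟶ Z) (by simp)) ?_
    hPZ hPZ
  exact
    { exact := ShortComplex.exact_of_isZero_X₂ _ hX
      mono_f := ⟨fun _ _ _ => hZ.eq_of_tgt _ _⟩
      epi_g := ⟨fun _ _ _ => hZ.eq_of_src _ _⟩ }

lemma prop_of_iso {X Y : 𝒜} (e : X ≅ Y) (hX : P X) : P Y := by
  refine P.prop_X₂_of_shortExact (S := ShortComplex.mk e.hom (0 : Y ⟶ (0 : 𝒜)) (by simp)) ?_
    hX (prop_of_isZero P (isZero_zero _))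
  exact
    { exact := (ShortComplex.exact_iff_epi _ rfl).2 (by dsimp; infer_instance)
      mono_f := by dsimp; infer_instance
      epi_g := ⟨fun _ _ _ => (isZero_zero 𝒜).eq_of_src _ _⟩ }

lemma prop_biprod {X Y : 𝒜} (hX : P X) (hY : P Y) : P (X ⊞ Y) :=
  P.prop_X₂_of_shortExact (S := ShortComplex.mk (biprod.inl : X ⟶ X ⊞ Y) biprod.snd (by simp))
    (ShortComplex.Splitting.ofHasBinaryBiproduct X Y).shortExact hX hY

end closure

variable (P : ObjectProperty 𝒜)

lemma IsProj.biprod [P.ContainsZero] [P.IsClosedUnderExtensions] {X Y : 𝒜}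
    (hX : IsProj P X) (hY : IsProj P Y) : IsProj P (X ⊞ Y) where
  mem := prop_biprod P hX.mem hY.mem
  lift S hS f := by
    obtain ⟨a, ha⟩ := hX.lift S hS (biprod.inl ≫ f)
    obtain ⟨b, hb⟩ := hY.lift S hS (biprod.inr ≫ f)
    exact ⟨biprod.desc a b, by ext <;> simp [ha, hb]⟩

variable [IsFrobenius P]

lemma isProj_zero : IsProj P (0 : 𝒜) where
  mem := prop_of_isZero P (isZero_zero _)
  lift _ _ _ := ⟨0, (isZero_zero 𝒜).eq_of_src _ _⟩

/-- The morphisms which factor through a projective object of `P`. -/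
def nullHom (X Y : 𝒜) : AddSubgroup (X ⟶ Y) where
  carrier := {f | ∃ (Q : 𝒜) (_ : IsProj P Q) (a : X ⟶ Q) (b : Q ⟶ Y), a ≫ b = f}
  zero_mem' := ⟨0, isProj_zero P, 0, 0, by simp⟩
  add_mem' := by
    rintro _ _ ⟨Q, hQ, a, b, rfl⟩ ⟨Q', hQ', a', b', rfl⟩
    exact ⟨Q ⊞ Q', hQ.biprod P hQ', biprod.lift a a', biprod.desc b b', by simp⟩
  neg_mem' := by
    rintro _ ⟨Q, hQ, a, b, rfl⟩
    exact ⟨Q, hQ, a, -b, by simp⟩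

variable {P}

lemma mem_nullHom_iff {X Y : 𝒜} (f : X ⟶ Y) : f ∈ nullHom P X Y ↔
    ∃ (Q : 𝒜) (_ : IsProj P Q) (a : X ⟶ Q) (b : Q ⟶ Y), a ≫ b = f := Iff.rfl

lemma nullHom_intro {X Q Y : 𝒜} (hQ : IsProj P Q) (a : X ⟶ Q) (b : Q ⟶ Y) :
    a ≫ b ∈ nullHom P X Y := ⟨Q, hQ, a, b, rfl⟩

lemma nullHom_precomp {X Y Z : 𝒜} (f : X ⟶ Y) {g : Y ⟶ Z} (hg : g ∈ nullHom P Y Z) :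
    f ≫ g ∈ nullHom P X Z := by
  obtain ⟨Q, hQ, a, b, rfl⟩ := hg
  exact ⟨Q, hQ, f ≫ a, b, by simp⟩

lemma nullHom_postcomp {X Y Z : 𝒜} {f : X ⟶ Y} (hf : f ∈ nullHom P X Y) (g : Y ⟶ Z) :
    f ≫ g ∈ nullHom P X Z := by
  obtain ⟨Q, hQ, a, b, rfl⟩ := hf
  exact ⟨Q, hQ, a, b ≫ g, by simp⟩

variable (P)

/-- The objects of the stable category of the Frobenius category `P`: the objects of `P`. -/
structure Stable where
  /-- The underlying object. -/
  obj : 𝒜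
  mem : P obj

variable {P}

/-- The stable category of the Frobenius category `P`: morphisms are taken modulo those which
factor through a projective object. -/
instance : Category (Stable P) where
  Hom X Y := (X.obj ⟶ Y.obj) ⧸ nullHom P X.obj Y.obj
  id X := QuotientAddGroup.mk (𝟙 X.obj)
  comp {X Y Z} f g := Quotient.map₂ (fun a b => a ≫ b) (by
    intro a a' h b b' h'
    replace h := QuotientAddGroup.leftRel_apply.1 h
    replace h' := QuotientAddGroup.leftRel_apply.1 h'
    refine QuotientAddGroup.leftRel_apply.2 ?_
    have : -(a ≫ b) + a' ≫ b' = (-a + a') ≫ b + a' ≫ (-b + b') := by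
      simp only [Preadditive.add_comp, Preadditive.comp_add, Preadditive.neg_comp,
        Preadditive.comp_neg]
      abel
    rw [this]
    exact add_mem (nullHom_postcomp h _) (nullHom_precomp _ h')) f g
  id_comp := by
    rintro X Y ⟨f⟩
    exact congrArg QuotientAddGroup.mk (id_comp f)
  comp_id := by
    rintro X Y ⟨f⟩
    exact congrArg QuotientAddGroup.mk (comp_id f)
  assoc := by
    rintro X Y Z W ⟨f⟩ ⟨g⟩ ⟨h⟩
    exact congrArg QuotientAddGroup.mk (assoc f g h)

namespace Stable

/-- The class of a morphism in the stable category. -/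
def cls {X Y : Stable P} (f : X.obj ⟶ Y.obj) : X ⟶ Y := QuotientAddGroup.mk f

lemma cls_surj {X Y : Stable P} (f : X ⟶ Y) : ∃ g : X.obj ⟶ Y.obj, cls g = f :=
  QuotientAddGroup.mk_surjective f

lemma cls_id (X : Stable P) : cls (𝟙 X.obj) = 𝟙 X := rfl

lemma cls_comp {X Y Z : Stable P} (f : X.obj ⟶ Y.obj) (g : Y.obj ⟶ Z.obj) :
    (cls (f ≫ g) : X ⟶ Z) = (cls f : X ⟶ Y) ≫ (cls g : Y ⟶ Z) := rfl

noncomputable instance : Preadditive (Stable P) where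
  homGroup X Y := inferInstanceAs (AddCommGroup ((X.obj ⟶ Y.obj) ⧸ nullHom P X.obj Y.obj))
  add_comp := by
    rintro X Y Z ⟨f⟩ ⟨f'⟩ ⟨g⟩
    exact congrArg QuotientAddGroup.mk (Preadditive.add_comp _ _ _ f f' g)
  comp_add := by
    rintro X Y Z ⟨f⟩ ⟨g⟩ ⟨g'⟩
    exact congrArg QuotientAddGroup.mk (Preadditive.comp_add _ _ _ f g g')

lemma cls_add {X Y : Stable P} (f g : X.obj ⟶ Y.obj) :
    (cls (f + g) : X ⟶ Y) = cls f + cls g := rfl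

lemma cls_neg {X Y : Stable P} (f : X.obj ⟶ Y.obj) : (cls (-f) : X ⟶ Y) = - cls f := rfl

lemma cls_zero {X Y : Stable P} : (cls 0 : X ⟶ Y) = 0 := rfl

lemma cls_eq_zero_iff {X Y : Stable P} (f : X.obj ⟶ Y.obj) :
    (cls f : X ⟶ Y) = 0 ↔ f ∈ nullHom P X.obj Y.obj :=
  QuotientAddGroup.eq_zero_iff f

lemma cls_eq_iff {X Y : Stable P} (f g : X.obj ⟶ Y.obj) :
    (cls f : X ⟶ Y) = cls g ↔ f - g ∈ nullHom P X.obj Y.obj := by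
  rw [← cls_eq_zero_iff, ← sub_eq_zero, sub_eq_add_neg, sub_eq_add_neg, cls_add, cls_neg]

instance : HasZeroObject (Stable P) where
  zero := ⟨⟨0, prop_of_isZero P (isZero_zero _)⟩, by
    rw [IsZero.iff_id_eq_zero, ← cls_id, cls_eq_zero_iff]
    exact ⟨0, isProj_zero P, 𝟙 _, 𝟙 _, comp_id _⟩⟩

instance : HasBinaryBiproducts (Stable P) where
  has_binary_biproduct X Y := hasBinaryBiproduct_of_total
    { pt := ⟨X.obj ⊞ Y.obj, prop_biprod P X.mem Y.mem⟩
      fst := cls biprod.fst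
      snd := cls biprod.snd
      inl := cls biprod.inl
      inr := cls biprod.inr
      inl_fst := congrArg cls biprod.inl_fst
      inl_snd := congrArg cls biprod.inl_snd
      inr_fst := congrArg cls biprod.inr_fst
      inr_snd := congrArg cls biprod.inr_snd }
    (congrArg cls (biprod.total (X := X.obj) (Y := Y.obj)))

end Stable

variable (P)

/-- A conflation `M ⟶ I ⟶ Z` of `P` with `I` projective-injective. -/
structure Hull (M : 𝒜) where
  (I Z : 𝒜)
  (ι : M ⟶ I)
  (π : I ⟶ Z)
  w : ι ≫ π = 0
  confl : IsConflation P (ShortComplex.mk ι π w)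
  proj : IsProj P I

variable {P}

lemma nonempty_hull {M : 𝒜} (hM : P M) : Nonempty (Hull P M) := by
  obtain ⟨I, Z, i, p, w, h, hI⟩ := IsFrobenius.enough_inj M hM
  exact ⟨⟨I, Z, i, p, w, h, (IsFrobenius.proj_iff_inj I).2 hI⟩⟩

namespace Hull

lemma mono {M : 𝒜} (H : Hull P M) : Mono H.ι := H.confl.exact.mono_f

lemma epi {M : 𝒜} (H : Hull P M) : Epi H.π := H.confl.exact.epi_g

lemma inj {M : 𝒜} (H : Hull P M) : IsInj P H.I := (IsFrobenius.proj_iff_inj _).1 H.proj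

/-- The cosyzygy as an object of the stable category. -/
abbrev cosyz {M : 𝒜} (H : Hull P M) : Stable P := ⟨H.Z, H.confl.mem₃⟩

/-- `f` and `ψ` are the outer components of a morphism of conflations. -/
def Rel {M N : 𝒜} (H : Hull P M) (H' : Hull P N) (f : M ⟶ N) (ψ : H.Z ⟶ H'.Z) : Prop :=
  ∃ φ : H.I ⟶ H'.I, H.ι ≫ φ = f ≫ H'.ι ∧ φ ≫ H'.π = H.π ≫ ψ

variable {M N L : 𝒜} (H : Hull P M) (H' : Hull P N) (H'' : Hull P L)

lemma exists_rel (f : M ⟶ N) : ∃ ψ, Rel H H' f ψ := by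
  obtain ⟨φ, hφ⟩ := H'.inj.ext _ H.confl (f ≫ H'.ι)
  dsimp at φ hφ
  have := H.epi
  obtain ⟨ψ, hψ⟩ : ∃ ψ, H.π ≫ ψ = φ ≫ H'.π :=
    ⟨H.confl.exact.exact.desc (φ ≫ H'.π) (by dsimp; rw [← assoc, hφ, assoc, H'.w, comp_zero]),
      H.confl.exact.exact.g_desc _ _⟩
  exact ⟨ψ, φ, hφ, hψ.symm⟩

lemma exists_rel' (ψ : H.Z ⟶ H'.Z) : ∃ f, Rel H H' f ψ := by
  obtain ⟨φ, hφ⟩ := H.proj.lift _ H'.confl (H.π ≫ ψ)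
  dsimp at φ hφ
  have := H'.mono
  obtain ⟨f, hf⟩ : ∃ f, f ≫ H'.ι = H.ι ≫ φ :=
    ⟨H'.confl.exact.exact.lift (H.ι ≫ φ) (by dsimp; rw [assoc, hφ, ← assoc, H.w, zero_comp]),
      H'.confl.exact.exact.lift_f _ _⟩
  exact ⟨f, φ, hf.symm, hφ⟩

variable {H H' H''}

lemma Rel.comp {f : M ⟶ N} {g : N ⟶ L} {ψ : H.Z ⟶ H'.Z} {ψ' : H'.Z ⟶ H''.Z}
    (h : Rel H H' f ψ) (h' : Rel H' H'' g ψ') : Rel H H'' (f ≫ g) (ψ ≫ ψ') := by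
  obtain ⟨φ, a, b⟩ := h
  obtain ⟨φ', a', b'⟩ := h'
  exact ⟨φ ≫ φ', by rw [← assoc, a, assoc, a', assoc], by rw [assoc, b', ← assoc, b, assoc]⟩

lemma Rel.add {f g : M ⟶ N} {ψ ψ' : H.Z ⟶ H'.Z}
    (h : Rel H H' f ψ) (h' : Rel H H' g ψ') : Rel H H' (f + g) (ψ + ψ') := by
  obtain ⟨φ, a, b⟩ := h
  obtain ⟨φ', a', b'⟩ := h'
  exact ⟨φ + φ', by rw [Preadditive.comp_add, a, a', Preadditive.add_comp],
    by rw [Preadditive.add_comp, b, b', Preadditive.comp_add]⟩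

lemma Rel.neg {f : M ⟶ N} {ψ : H.Z ⟶ H'.Z} (h : Rel H H' f ψ) : Rel H H' (-f) (-ψ) := by
  obtain ⟨φ, a, b⟩ := h
  exact ⟨-φ, by simp [a], by simp [b]⟩

lemma Rel.sub {f g : M ⟶ N} {ψ ψ' : H.Z ⟶ H'.Z}
    (h : Rel H H' f ψ) (h' : Rel H H' g ψ') : Rel H H' (f - g) (ψ - ψ') := by
  rw [sub_eq_add_neg, sub_eq_add_neg]
  exact h.add h'.neg

variable (H) in
lemma Rel.id : Rel H H (𝟙 M) (𝟙 H.Z) := ⟨𝟙 _, by simp, by simp⟩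

lemma Rel.mem_nullHom {f : M ⟶ N} {ψ : H.Z ⟶ H'.Z} (h : Rel H H' f ψ)
    (hf : f ∈ nullHom P M N) : ψ ∈ nullHom P H.Z H'.Z := by
  obtain ⟨φ, a, b⟩ := h
  obtain ⟨Q, hQ, s, t, rfl⟩ := hf
  obtain ⟨s', hs'⟩ := ((IsFrobenius.proj_iff_inj Q).1 hQ).ext _ H.confl s
  dsimp at s' hs'
  have := H.epi
  obtain ⟨k, hk⟩ : ∃ k, H.π ≫ k = φ - s' ≫ t ≫ H'.ι :=
    ⟨H.confl.exact.exact.desc (φ - s' ≫ t ≫ H'.ι)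
      (by dsimp; rw [Preadditive.comp_sub, a, ← hs']; simp), H.confl.exact.exact.g_desc _ _⟩
  have : ψ = k ≫ H'.π := by
    rw [← cancel_epi H.π, ← b, ← assoc, hk]
    simp [H'.w]
  rw [this]
  exact nullHom_intro H'.proj _ _

lemma Rel.mem_nullHom' {f : M ⟶ N} {ψ : H.Z ⟶ H'.Z} (h : Rel H H' f ψ)
    (hψ : ψ ∈ nullHom P H.Z H'.Z) : f ∈ nullHom P M N := by
  obtain ⟨φ, a, b⟩ := h
  obtain ⟨Q, hQ, s, t, rfl⟩ := hψ
  obtain ⟨t', ht'⟩ := hQ.lift _ H'.confl t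
  dsimp at t' ht'
  have := H'.mono
  obtain ⟨k, hk⟩ : ∃ k, k ≫ H'.ι = φ - H.π ≫ s ≫ t' :=
    ⟨H'.confl.exact.exact.lift (φ - H.π ≫ s ≫ t')
      (by dsimp; rw [Preadditive.sub_comp, b, ← ht']; simp), H'.confl.exact.exact.lift_f _ _⟩
  have : f = H.ι ≫ k := by
    rw [← cancel_mono H'.ι, ← a, assoc, hk, Preadditive.comp_sub, ← assoc H.ι, H.w]
    simp
  rw [this]
  exact nullHom_intro H.proj _ _

end Hull

namespace Stable

/-- The morphism between cosyzygies induced by a morphism of the stable category. -/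
noncomputable def cosyzMap {X Y : Stable P} (H : Hull P X.obj) (H' : Hull P Y.obj) (f : X ⟶ Y) :
    H.cosyz ⟶ H'.cosyz :=
  cls (X := H.cosyz) (Y := H'.cosyz) (H.exists_rel H' (cls_surj f).choose).choose

lemma cosyzMap_eq {X Y : Stable P} {H : Hull P X.obj} {H' : Hull P Y.obj} {f : X.obj ⟶ Y.obj}
    {ψ : H.Z ⟶ H'.Z} (h : H.Rel H' f ψ) :
    cosyzMap (X := X) (Y := Y) H H' (cls f) = cls (X := H.cosyz) (Y := H'.cosyz) ψ := by
  rw [cosyzMap, cls_eq_iff]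
  have h₁ := (H.exists_rel H' (cls_surj (X := X) (Y := Y) (cls f)).choose).choose_spec
  have h₂ := (cls_surj (X := X) (Y := Y) (cls f)).choose_spec
  rw [cls_eq_iff] at h₂
  exact (h₁.sub h).mem_nullHom h₂

lemma cosyzMap_id {X : Stable P} (H : Hull P X.obj) : cosyzMap H H (𝟙 X) = 𝟙 H.cosyz :=
  cosyzMap_eq (X := X) (Y := X) (Hull.Rel.id H)

lemma cosyzMap_comp {X Y Z : Stable P} (H : Hull P X.obj) (H' : Hull P Y.obj)
    (H'' : Hull P Z.obj) (f : X ⟶ Y) (g : Y ⟶ Z) :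
    cosyzMap H H'' (f ≫ g) = cosyzMap H H' f ≫ cosyzMap H' H'' g := by
  obtain ⟨f, rfl⟩ := cls_surj f
  obtain ⟨g, rfl⟩ := cls_surj g
  obtain ⟨ψ, h⟩ := H.exists_rel H' f
  obtain ⟨ψ', h'⟩ := H'.exists_rel H'' g
  rw [← cls_comp, cosyzMap_eq h, cosyzMap_eq h', cosyzMap_eq (h.comp h')]
  rfl

lemma cosyzMap_injective {X Y : Stable P} (H : Hull P X.obj) (H' : Hull P Y.obj) :
    Function.Injective (cosyzMap (X := X) (Y := Y) H H') := by
  intro f g e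
  obtain ⟨f, rfl⟩ := cls_surj f
  obtain ⟨g, rfl⟩ := cls_surj g
  obtain ⟨ψ, h⟩ := H.exists_rel H' f
  obtain ⟨ψ', h'⟩ := H.exists_rel H' g
  rw [cosyzMap_eq h, cosyzMap_eq h', cls_eq_iff] at e
  rw [cls_eq_iff]
  exact (h.sub h').mem_nullHom' e

lemma cosyzMap_surjective {X Y : Stable P} (H : Hull P X.obj) (H' : Hull P Y.obj) :
    Function.Surjective (cosyzMap (X := X) (Y := Y) H H') := by
  intro g
  obtain ⟨ψ, rfl⟩ := cls_surj g
  obtain ⟨f, h⟩ := H.exists_rel' H' ψ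
  exact ⟨cls f, cosyzMap_eq h⟩

/-- The chosen conflation `X ⟶ I ⟶ ΣX` with `I` projective-injective. -/
noncomputable def hull (X : Stable P) : Hull P X.obj := (nonempty_hull X.mem).some

/-- The canonical isomorphism between two cosyzygies of an object. -/
noncomputable def cosyzIso {X : Stable P} (H H' : Hull P X.obj) : H.cosyz ≅ H'.cosyz where
  hom := cosyzMap (X := X) (Y := X) H H' (𝟙 X)
  inv := cosyzMap (X := X) (Y := X) H' H (𝟙 X)
  hom_inv_id := by rw [← cosyzMap_comp, comp_id, cosyzMap_id]
  inv_hom_id := by rw [← cosyzMap_comp, comp_id, cosyzMap_id]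

variable (P) in
/-- The suspension functor of the stable category. -/
noncomputable def susp : Stable P ⥤ Stable P where
  obj X := X.hull.cosyz
  map {X Y} f := cosyzMap X.hull Y.hull f
  map_id _ := cosyzMap_id _
  map_comp f g := cosyzMap_comp _ _ _ f g

instance : (susp P).Faithful where
  map_injective {X Y} _ _ h := cosyzMap_injective X.hull Y.hull h

instance : (susp P).Full where
  map_surjective {X Y} := cosyzMap_surjective X.hull Y.hull

instance : (susp P).EssSurj where
  mem_essImage Y := by
    obtain ⟨K, Q, i, p, w, h, hQ⟩ := IsFrobenius.enough_proj Y.obj Y.mem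
    let X : Stable P := ⟨K, h.mem₁⟩
    let H : Hull P X.obj := ⟨Q, Y.obj, i, p, w, h, hQ⟩
    exact ⟨X, ⟨cosyzIso X.hull H⟩⟩

instance : (susp P).IsEquivalence where

noncomputable instance : HasShift (Stable P) ℤ := AutoShift.hasShift (susp P)

/-- The shift by `1` is the suspension functor. -/
noncomputable def shiftIso : shiftFunctor (Stable P) (1 : ℤ) ≅ susp P :=
  AutoShift.shiftOneIso (susp P)

instance (n : ℤ) : (shiftFunctor (Stable P) n).Additive :=
  have := preservesBinaryBiproducts_of_preservesBinaryProducts (shiftFunctor (Stable P) n)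
  Functor.additive_of_preservesBinaryBiproducts _

end Stable

end Frob

/-! ### The triangulated structure of the stable category -/

namespace Frob

universe v u

variable {𝒜 : Type u} [Category.{v} 𝒜] [Abelian 𝒜] {P : ObjectProperty 𝒜} [IsFrobenius P]

/-- A morphism of conflations from `X ⟶ I ⟶ ΣX` to `Y ⟶ Z ⟶ ΣX` which is the identity on `ΣX`
(so that `Z` is the pushout of `X ⟶ I` along `u : X ⟶ Y`). -/
structure IsCone {X Y Z : 𝒜} (H : Hull P X) (u : X ⟶ Y) (v : Y ⟶ Z) (w : Z ⟶ H.Z)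
    (k : H.I ⟶ Z) : Prop where
  zero : v ≫ w = 0
  confl : IsConflation P (ShortComplex.mk v w zero)
  comm₁ : H.ι ≫ k = u ≫ v
  comm₂ : k ≫ w = H.π

lemma IsCone.total {X Y Z : 𝒜} {H : Hull P X} {u : X ⟶ Y} {v : Y ⟶ Z} {w : Z ⟶ H.Z}
    {k : H.I ⟶ Z} (h : IsCone H u v w k) (hX : P X) :
    IsConflation P (ShortComplex.mk (biprod.lift u H.ι) (biprod.desc v (-k))
      (by simp [h.comm₁])) where
  mem₁ := hX
  mem₂ := prop_biprod P h.confl.mem₁ H.proj.mem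
  mem₃ := h.confl.mem₂
  exact :=
    { mono_f := by
        have := H.mono
        exact mono_of_mono_fac (biprod.lift_snd u H.ι)
      epi_g := by
        have := H.epi
        have := h.confl.exact.epi_g
        refine Preadditive.epi_of_cancel_zero _ (fun {W} t ht => ?_)
        have h1 : v ≫ t = 0 := by
          have := congrArg (biprod.inl ≫ ·) ht
          simpa using this
        have h2 : k ≫ t = 0 := by
          have := congrArg (biprod.inr ≫ ·) ht
          simpa using this
        have h3 := h.confl.exact.exact.g_desc t h1
        dsimp at h3
        rw [← h3, ← assoc, h.comm₂] at h2
        have h4 := (cancel_epi H.π).1 (h2.trans comp_zero.symm)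
        rw [← h3, h4, comp_zero]
      exact := by
        rw [ShortComplex.exact_iff_exact_up_to_refinements]
        intro A t ht
        dsimp at t ht
        have := H.mono
        have := h.confl.exact.mono_f
        have e : (t ≫ biprod.fst) ≫ v = (t ≫ biprod.snd) ≫ k := by
          rw [← sub_eq_zero, ← ht, biprod.desc_eq]
          simp [sub_eq_add_neg]
        have e' : (t ≫ biprod.snd) ≫ H.π = 0 := by
          rw [← h.comm₂, ← assoc, ← e, assoc, h.zero, comp_zero]
        have h3 := H.confl.exact.exact.lift_f _ e'
        set s := H.confl.exact.exact.lift _ e'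
        dsimp at s h3
        have h4 : s ≫ u = t ≫ biprod.fst := by
          rw [← cancel_mono v, assoc, ← h.comm₁, ← assoc, h3, e]
        refine ⟨A, 𝟙 A, inferInstance, s, ?_⟩
        dsimp
        ext <;> simp [h3, h4] }

lemma exists_isCone {X Y : 𝒜} (H : Hull P X) (u : X ⟶ Y) (hY : P Y) :
    ∃ (Z : 𝒜) (v : Y ⟶ Z) (w : Z ⟶ H.Z) (k : H.I ⟶ Z), IsCone H u v w k := by
  have := H.mono
  have := H.epi
  have sq := IsPushout.of_hasPushout u H.ι
  have hw : pushout.inr u H.ι ≫ pushout.desc 0 H.π (by rw [comp_zero, H.w]) = H.π :=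
    pushout.inr_desc _ _ _
  have hv : pushout.inl u H.ι ≫ pushout.desc 0 H.π (by rw [comp_zero, H.w]) = 0 :=
    pushout.inl_desc _ _ _
  have ex : (ShortComplex.mk _ _ hv).ShortExact :=
    { mono_f := by dsimp; infer_instance
      epi_g := epi_of_epi_fac hw
      exact := by
        rw [ShortComplex.exact_iff_exact_up_to_refinements]
        intro A t ht
        dsimp at t ht
        obtain ⟨A', e, he, a, b, hab⟩ := sq.hom_eq_add_up_to_refinements t
        have hb : b ≫ H.π = 0 := by
          have := congrArg (e ≫ ·) ht
          simp only [comp_zero] at this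
          rw [← assoc, hab, Preadditive.add_comp, assoc, assoc, hv, hw] at this
          simpa using this
        have h3 := H.confl.exact.exact.lift_f _ hb
        set s := H.confl.exact.exact.lift _ hb
        dsimp at s h3
        refine ⟨A', e, he, a + s ≫ u, ?_⟩
        dsimp
        rw [hab, Preadditive.add_comp, assoc, sq.w, ← assoc, h3] }
  exact ⟨pushout u H.ι, _, _, pushout.inr u H.ι, hv,
    ⟨ex, hY, P.prop_X₂_of_shortExact ex hY H.confl.mem₃, H.confl.mem₃⟩, sq.w.symm, hw⟩

/-- `δ` is a connecting morphism of the conflation `X ⟶ Y ⟶ Z` (up to the sign). -/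
def IsConn {X Y Z : 𝒜} (H : Hull P X) (u : X ⟶ Y) (v : Y ⟶ Z) (δ : Z ⟶ H.Z) : Prop :=
  ∃ g : Y ⟶ H.I, u ≫ g = H.ι ∧ g ≫ H.π = v ≫ δ

lemma exists_isConn {X Y Z : 𝒜} (H : Hull P X) {u : X ⟶ Y} {v : Y ⟶ Z} {w : u ≫ v = 0}
    (h : IsConflation P (ShortComplex.mk u v w)) : ∃ δ, IsConn H u v δ := by
  obtain ⟨g, hg⟩ := H.inj.ext _ h H.ι
  dsimp at g hg
  have e : u ≫ g ≫ H.π = 0 := by rw [← assoc, hg, H.w]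
  have := h.exact.epi_g
  exact ⟨h.exact.exact.desc _ e, g, hg, (h.exact.exact.g_desc _ e).symm⟩

lemma IsConn.isCone {X Y Z : 𝒜} {H : Hull P X} {u : X ⟶ Y} {v : Y ⟶ Z} {w : u ≫ v = 0}
    {δ : Z ⟶ H.Z} (h : IsConflation P (ShortComplex.mk u v w)) {g : Y ⟶ H.I}
    (hg : u ≫ g = H.ι) (hg' : g ≫ H.π = v ≫ δ) :
    IsCone H u (biprod.lift v g) (biprod.desc (-δ) H.π) biprod.inr where
  zero := by simp [hg']
  comm₁ := by ext <;> simp [w, hg]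
  comm₂ := by simp
  confl :=
    { mem₁ := h.mem₂
      mem₂ := prop_biprod P h.mem₃ H.proj.mem
      mem₃ := H.confl.mem₃
      exact :=
        { mono_f := by
            have := H.mono
            refine Preadditive.mono_of_cancel_zero _ (fun {W} t ht => ?_)
            have h1 : t ≫ v = 0 := by
              have := congrArg (· ≫ biprod.fst) ht
              simpa using this
            have h2 : t ≫ g = 0 := by
              have := congrArg (· ≫ biprod.snd) ht
              simpa using this
            have := h.exact.mono_f
            have h3 := h.exact.exact.lift_f t h1
            dsimp at h3
            rw [← h3, assoc, hg] at h2
            have h4 := (cancel_mono H.ι).1 (h2.trans zero_comp.symm)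
            rw [← h3, h4, zero_comp]
          epi_g := by
            have := H.epi
            exact epi_of_epi_fac (biprod.inr_desc (-δ) H.π)
          exact := by
            rw [ShortComplex.exact_iff_exact_up_to_refinements]
            intro A t ht
            dsimp at t ht
            have := h.exact.epi_g
            obtain ⟨A', e, he, y, hy⟩ := surjective_up_to_refinements_of_epi v (t ≫ biprod.fst)
            have ht' : (t ≫ biprod.snd) ≫ H.π = (t ≫ biprod.fst) ≫ δ := by
              rw [← sub_eq_zero, ← ht, biprod.desc_eq]
              simp [sub_eq_neg_add]
            have e2 : (e ≫ (t ≫ biprod.snd) - y ≫ g) ≫ H.π = 0 := by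
              rw [Preadditive.sub_comp, assoc, ht', assoc y, hg', ← assoc e, hy, assoc, sub_self]
            have := H.mono
            have h3 := H.confl.exact.exact.lift_f _ e2
            set s := H.confl.exact.exact.lift _ e2
            dsimp at s h3
            refine ⟨A', e, he, y + s ≫ u, ?_⟩
            dsimp
            ext
            · simp [hy, w]
            · simp only [assoc, biprod.lift_snd, Preadditive.add_comp, hg, h3]
              abel } }

lemma IsConn.naturality {X Y Z X' Y' Z' : 𝒜} {H : Hull P X} {H' : Hull P X'}
    {u : X ⟶ Y} {v : Y ⟶ Z} {w : u ≫ v = 0} (h : IsConflation P (ShortComplex.mk u v w))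
    {u' : X' ⟶ Y'} {v' : Y' ⟶ Z'} {δ : Z ⟶ H.Z} {δ' : Z' ⟶ H'.Z}
    (hδ : IsConn H u v δ) (hδ' : IsConn H' u' v' δ') {α : X ⟶ X'} {β : Y ⟶ Y'} {γ : Z ⟶ Z'}
    (h₁ : u ≫ β = α ≫ u') (h₂ : v ≫ γ = β ≫ v') {ψ : H.Z ⟶ H'.Z} (hψ : H.Rel H' α ψ) :
    γ ≫ δ' - δ ≫ ψ ∈ nullHom P Z H'.Z := by
  obtain ⟨g, a, b⟩ := hδ
  obtain ⟨g', a', b'⟩ := hδ'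
  obtain ⟨φ, c, d⟩ := hψ
  have e : u ≫ (β ≫ g' - g ≫ φ) = 0 := by
    rw [Preadditive.comp_sub, ← assoc, ← assoc, h₁, a, assoc, a', c, sub_self]
  have := h.exact.epi_g
  have h3 := h.exact.exact.g_desc _ e
  set t := h.exact.exact.desc _ e
  dsimp at t h3
  have : γ ≫ δ' - δ ≫ ψ = t ≫ H'.π := by
    have epi : Epi v := h.exact.epi_g
    rw [← cancel_epi v, Preadditive.comp_sub, ← assoc, ← assoc, h₂, ← b, assoc, ← b', assoc, ← d,
      ← assoc v, h3, Preadditive.sub_comp, assoc, assoc]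
  rw [this]
  exact nullHom_intro H'.proj _ _

namespace Stable

open Pretriangulated

/-- The canonical isomorphism from the cosyzygy to the shift. -/
noncomputable def shiftHull {X : Stable P} (H : Hull P X.obj) : H.cosyz ≅ X⟦(1 : ℤ)⟧ :=
  cosyzIso H X.hull ≪≫ (shiftIso.app X).symm

lemma shiftHull_naturality {X Y : Stable P} (H : Hull P X.obj) (H' : Hull P Y.obj) (f : X ⟶ Y) :
    cosyzMap H H' f ≫ (shiftHull H').hom = (shiftHull H).hom ≫ f⟦(1 : ℤ)⟧' := by
  have h1 : (shiftHull H').hom = cosyzMap H' Y.hull (𝟙 Y) ≫ shiftIso.inv.app Y := rfl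
  have h2 : (shiftHull H).hom = cosyzMap H X.hull (𝟙 X) ≫ shiftIso.inv.app X := rfl
  have h3 : cosyzMap X.hull Y.hull f ≫ shiftIso.inv.app Y =
    shiftIso.inv.app X ≫ f⟦(1 : ℤ)⟧' := shiftIso.inv.naturality f
  have h4 : cosyzMap H H' f ≫ cosyzMap H' Y.hull (𝟙 Y) =
      cosyzMap H X.hull (𝟙 X) ≫ cosyzMap X.hull Y.hull f := by
    rw [← cosyzMap_comp, ← cosyzMap_comp, comp_id, id_comp]
  rw [h1, h2]
  refine (assoc _ _ _).symm.trans ((congrArg (· ≫ shiftIso.inv.app Y) h4).trans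
    ((assoc _ _ _).trans ((congrArg (cosyzMap H X.hull (𝟙 X) ≫ ·) h3).trans ?_)))
  exact (assoc _ _ _).symm

/-- An isomorphism of triangles. -/
noncomputable def triIso {X Y Z X' Y' Z' : Stable P} {f : X ⟶ Y} {g : Y ⟶ Z} {h : Z ⟶ X⟦(1 : ℤ)⟧}
    {f' : X' ⟶ Y'} {g' : Y' ⟶ Z'} {h' : Z' ⟶ X'⟦(1 : ℤ)⟧} (e₁ : X ≅ X') (e₂ : Y ≅ Y')
    (e₃ : Z ≅ Z') (c₁ : f ≫ e₂.hom = e₁.hom ≫ f') (c₂ : g ≫ e₃.hom = e₂.hom ≫ g')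
    (c₃ : h ≫ e₁.hom⟦(1 : ℤ)⟧' = e₃.hom ≫ h') :
    Triangle.mk f g h ≅ Triangle.mk f' g' h' :=
  Triangle.isoMk _ _ e₁ e₂ e₃ c₁ c₂ c₃

/-- The standard triangle `X ⟶ Y ⟶ Z ⟶ X⟦1⟧` on morphisms `u`, `v`, `w`. -/
noncomputable abbrev triangle {X Y Z : Stable P} (H : Hull P X.obj) (u : X.obj ⟶ Y.obj)
    (v : Y.obj ⟶ Z.obj) (w : Z.obj ⟶ H.Z) : Triangle (Stable P) :=
  Triangle.mk (cls u : X ⟶ Y) (cls v : Y ⟶ Z)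
    ((cls (Y := H.cosyz) w : Z ⟶ H.cosyz) ≫ (shiftHull H).hom)

variable (P) in
/-- The distinguished triangles: those isomorphic to the standard triangle
`X ⟶ Y ⟶ Z ⟶ ΣX` of a morphism `u : X ⟶ Y`, where `Z` is the pushout of an embedding `X ⟶ I`
into a projective-injective object along `u`. -/
def distinguished : Set (Triangle (Stable P)) :=
  {T | ∃ (X Y Z : Stable P) (H : Hull P X.obj) (u : X.obj ⟶ Y.obj) (v : Y.obj ⟶ Z.obj)
    (w : Z.obj ⟶ H.Z) (k : H.I ⟶ Z.obj), IsCone H u v w k ∧ Nonempty (T ≅ triangle H u v w)}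

lemma distinguished_of_iso {T T' : Triangle (Stable P)} (e : T ≅ T')
    (h : T' ∈ distinguished P) : T ∈ distinguished P := by
  obtain ⟨X, Y, Z, H, u, v, w, k, hc, ⟨e'⟩⟩ := h
  exact ⟨X, Y, Z, H, u, v, w, k, hc, ⟨e ≪≫ e'⟩⟩

lemma IsCone.mem {X Y Z : Stable P} {H : Hull P X.obj} {u : X.obj ⟶ Y.obj}
    {v : Y.obj ⟶ Z.obj} {w : Z.obj ⟶ H.Z} {k : H.I ⟶ Z.obj} (h : IsCone H u v w k) :
    triangle H u v w ∈ distinguished P := ⟨X, Y, Z, H, u, v, w, k, h, ⟨Iso.refl _⟩⟩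

/-- Adding a projective object does not change the object of the stable category. -/
noncomputable def biprodIso (X : Stable P) {I : 𝒜} (hI : IsProj P I) :
    (⟨X.obj ⊞ I, prop_biprod P X.mem hI.mem⟩ : Stable P) ≅ X where
  hom := cls (X := ⟨X.obj ⊞ I, prop_biprod P X.mem hI.mem⟩) biprod.fst
  inv := cls (Y := ⟨X.obj ⊞ I, prop_biprod P X.mem hI.mem⟩) biprod.inl
  hom_inv_id := by
    rw [← cls_comp, ← cls_id, cls_eq_iff]
    have : (biprod.fst ≫ biprod.inl - 𝟙 (X.obj ⊞ I) : X.obj ⊞ I ⟶ X.obj ⊞ I) =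
        biprod.snd ≫ (-biprod.inr) := by
      rw [← biprod.total, Preadditive.comp_neg]
      abel
    exact this ▸ nullHom_intro hI _ _
  inv_hom_id := by
    rw [← cls_comp, ← cls_id, cls_eq_iff, biprod.inl_fst, sub_self]
    exact zero_mem _

/-- The triangle of a conflation. -/
noncomputable abbrev conflTriangle {X Y Z : Stable P} (H : Hull P X.obj) (u : X.obj ⟶ Y.obj)
    (v : Y.obj ⟶ Z.obj) (δ : Z.obj ⟶ H.Z) : Triangle (Stable P) :=
  Triangle.mk (cls u : X ⟶ Y) (cls v : Y ⟶ Z)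
    (-((cls (Y := H.cosyz) δ : Z ⟶ H.cosyz) ≫ (shiftHull H).hom))

lemma conflTriangle_mem {X Y Z : Stable P} {H : Hull P X.obj} {u : X.obj ⟶ Y.obj}
    {v : Y.obj ⟶ Z.obj} {w : u ≫ v = 0} {δ : Z.obj ⟶ H.Z}
    (h : IsConflation P (ShortComplex.mk u v w)) (hδ : IsConn H u v δ) :
    conflTriangle H u v δ ∈ distinguished P := by
  obtain ⟨g, hg, hg'⟩ := hδ
  have hc := IsConn.isCone h hg hg'
  let Z' : Stable P := ⟨Z.obj ⊞ H.I, prop_biprod P Z.mem H.proj.mem⟩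
  refine ⟨X, Y, Z', H, u, _, _, _, hc, ⟨?_⟩⟩
  refine (triIso (Iso.refl _) (Iso.refl _) (biprodIso Z H.proj) ?_ ?_ ?_).symm
  · rw [Iso.refl_hom, Iso.refl_hom, comp_id, id_comp]
  · rw [Iso.refl_hom, id_comp]
    change cls (X := Y) (Y := Z) (biprod.lift v g ≫ biprod.fst) = _
    rw [biprod.lift_fst]
  · rw [Iso.refl_hom]
    rw [CategoryTheory.Functor.map_id, comp_id, Preadditive.comp_neg, ← assoc, ← Preadditive.neg_comp]
    congr 1
    change cls (X := Z') (Y := H.cosyz) (biprod.desc (-δ) H.π) =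
      cls (X := Z') (Y := H.cosyz) (-(biprod.fst ≫ δ))
    rw [cls_eq_iff]
    have : (biprod.desc (-δ) H.π - -(biprod.fst ≫ δ) : Z.obj ⊞ H.I ⟶ H.Z) =
        biprod.snd ≫ H.π := by
      ext <;> simp
    rw [this]
    exact nullHom_intro H.proj _ _

lemma conn_naturality {X Y Z X' Y' Z' : Stable P} {H : Hull P X.obj} {H' : Hull P X'.obj}
    {u : X.obj ⟶ Y.obj} {v : Y.obj ⟶ Z.obj} {w : u ≫ v = 0}
    (h : IsConflation P (ShortComplex.mk u v w))
    {u' : X'.obj ⟶ Y'.obj} {v' : Y'.obj ⟶ Z'.obj} {δ : Z.obj ⟶ H.Z} {δ' : Z'.obj ⟶ H'.Z}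
    (hδ : IsConn H u v δ) (hδ' : IsConn H' u' v' δ') {α : X.obj ⟶ X'.obj} {β : Y.obj ⟶ Y'.obj}
    {γ : Z.obj ⟶ Z'.obj} (h₁ : u ≫ β = α ≫ u') (h₂ : v ≫ γ = β ≫ v') :
    (cls γ : Z ⟶ Z') ≫ (cls (Y := H'.cosyz) δ' : Z' ⟶ H'.cosyz) ≫ (shiftHull H').hom =
      ((cls (Y := H.cosyz) δ : Z ⟶ H.cosyz) ≫ (shiftHull H).hom) ≫
        (cls α : X ⟶ X')⟦(1 : ℤ)⟧' := by
  obtain ⟨ψ, hψ⟩ := H.exists_rel H' α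
  have h3 := IsConn.naturality h hδ hδ' h₁ h₂ hψ
  rw [assoc, ← shiftHull_naturality H H', cosyzMap_eq hψ, ← assoc, ← assoc]
  congr 1
  exact (cls_eq_iff (X := Z) (Y := H'.cosyz) (γ ≫ δ') (δ ≫ ψ)).2 h3

lemma contractible_mem (X : Stable P) : contractibleTriangle X ∈ distinguished P := by
  let H := X.hull
  let I : Stable P := ⟨H.I, H.proj.mem⟩
  have hc : IsCone H (𝟙 X.obj) H.ι H.π (𝟙 H.I) := ⟨H.w, H.confl, by simp, by simp⟩
  have hI : IsZero I := by
    rw [IsZero.iff_id_eq_zero, ← cls_id, cls_eq_zero_iff]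
    exact ⟨H.I, H.proj, 𝟙 _, 𝟙 _, comp_id _⟩
  refine ⟨X, X, I, H, _, _, _, _, hc, ⟨?_⟩⟩
  refine triIso (Iso.refl _) (Iso.refl _) ((isZero_zero _).iso hI) ?_ ?_ ?_
  · rw [Iso.refl_hom, comp_id, id_comp, cls_id]
  · exact hI.eq_of_tgt _ _
  · exact (isZero_zero _).eq_of_src _ _

lemma cocone_mem {X Y : Stable P} (f : X ⟶ Y) : ∃ (Z : Stable P) (g : Y ⟶ Z)
    (h : Z ⟶ X⟦(1 : ℤ)⟧), Triangle.mk f g h ∈ distinguished P := by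
  obtain ⟨u, rfl⟩ := cls_surj f
  obtain ⟨Z, v, w, k, hc⟩ := exists_isCone X.hull u Y.mem
  exact ⟨⟨Z, hc.confl.mem₂⟩, _, _,
    IsCone.mem (X := X) (Y := Y) (Z := ⟨Z, hc.confl.mem₂⟩) hc⟩

/-- The rotation of a standard triangle is the triangle of a conflation. -/
lemma nonempty_rotate_iso {X Y Z : Stable P} {H : Hull P X.obj} {u : X.obj ⟶ Y.obj}
    {v : Y.obj ⟶ Z.obj} {w : Z.obj ⟶ H.Z} {k : H.I ⟶ Z.obj} (hc : IsCone H u v w k)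
    {H' : Hull P Y.obj} {δ : H.Z ⟶ H'.Z} (hδ : IsConn H' v w δ) :
    Nonempty ((triangle H u v w).rotate ≅
      conflTriangle (X := Y) (Y := Z) (Z := H.cosyz) H' v w δ) := by
  change Nonempty (Triangle.mk (cls v : Y ⟶ Z)
    ((cls (Y := H.cosyz) w : Z ⟶ H.cosyz) ≫ (shiftHull H).hom)
    (-(cls u : X ⟶ Y)⟦(1 : ℤ)⟧') ≅ _)
  refine ⟨(triIso (Iso.refl _) (Iso.refl _) (shiftHull H) ?_ ?_ ?_).symm⟩
  · rw [Iso.refl_hom, Iso.refl_hom, comp_id, id_comp]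
  · rw [Iso.refl_hom, id_comp]
  · rw [Iso.refl_hom, CategoryTheory.Functor.map_id, comp_id, Preadditive.comp_neg]
    congr 1
    obtain ⟨g, a, b⟩ := hδ
    have hr : H.Rel H' u δ :=
      ⟨k ≫ g, by rw [← assoc, hc.comm₁, assoc, a], by rw [assoc, b, ← assoc, hc.comm₂]⟩
    rw [← shiftHull_naturality H H', cosyzMap_eq hr]

lemma rotate_mem {T : Triangle (Stable P)} (hT : T ∈ distinguished P) :
    T.rotate ∈ distinguished P := by
  obtain ⟨X, Y, Z, H, u, v, w, k, hc, ⟨e⟩⟩ := hT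
  obtain ⟨δ, hδ⟩ := exists_isConn Y.hull hc.confl
  obtain ⟨e'⟩ := nonempty_rotate_iso hc hδ
  exact distinguished_of_iso ((triangleRotation _).functor.mapIso e ≪≫ e')
    (conflTriangle_mem (Z := H.cosyz) hc.confl hδ)

lemma exists_rotate_iso {T : Triangle (Stable P)} (hT : T ∈ distinguished P) :
    ∃ T' ∈ distinguished P, Nonempty (T'.rotate ≅ T) := by
  obtain ⟨Y, Z, W, H, v, w, h, k, hc, ⟨e⟩⟩ := hT
  have ht := hc.total Y.mem
  obtain ⟨K, Q, i, p, hip, hK, hQ⟩ := IsFrobenius.enough_proj W.obj W.mem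
  let X : Stable P := ⟨K, hK.mem₁⟩
  let G : Hull P X.obj := ⟨Q, W.obj, i, p, hip, hK, hQ⟩
  let Z' : Stable P := ⟨Z.obj ⊞ H.I, prop_biprod P Z.mem H.proj.mem⟩
  obtain ⟨q, hq⟩ := hQ.lift _ ht p
  dsimp at q hq
  have hiq : (i ≫ q) ≫ biprod.desc w (-k) = 0 := by rw [assoc, hq, hip]
  have := ht.exact.mono_f
  have h3 := ht.exact.exact.lift_f _ hiq
  set u := ht.exact.exact.lift _ hiq
  dsimp at u h3
  have hG : IsCone (Y := Y.obj) (Z := Z'.obj) G u (biprod.lift v H.ι) (biprod.desc w (-k)) q :=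
    ⟨_, ht, h3.symm, hq⟩
  have hδ : IsConn (Y := Z'.obj) (Z := G.Z) H (biprod.lift v H.ι) (biprod.desc w (-k)) (-h) :=
    ⟨biprod.snd, by simp, by ext <;> simp [hc.zero, hc.comm₂]⟩
  refine ⟨_, IsCone.mem (X := X) (Y := Y) (Z := Z') hG, ?_⟩
  obtain ⟨e'⟩ := nonempty_rotate_iso (X := X) (Y := Y) (Z := Z') hG hδ
  refine ⟨e' ≪≫ ?_ ≪≫ e.symm⟩
  refine triIso (Iso.refl _) (biprodIso Z H.proj) (Iso.refl _) ?_ ?_ ?_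
  · rw [Iso.refl_hom, id_comp]
    change cls (X := Y) (Y := Z) (biprod.lift v H.ι ≫ biprod.fst) = _
    rw [biprod.lift_fst]
  · change cls (X := Z') (Y := W) (biprod.desc w (-k)) ≫ 𝟙 _ =
      cls (X := Z') (Y := W) (biprod.fst ≫ w)
    rw [comp_id, cls_eq_iff]
    have : (biprod.desc w (-k) - biprod.fst ≫ w : Z.obj ⊞ H.I ⟶ W.obj) =
        biprod.snd ≫ (-k) := by
      ext <;> simp
    rw [this]
    exact nullHom_intro H.proj _ _
  · rw [Iso.refl_hom, Iso.refl_hom, CategoryTheory.Functor.map_id, comp_id, id_comp, ← Preadditive.neg_comp]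
    congr 1
    change -cls (X := W) (Y := H.cosyz) (-h) = _
    rw [cls_neg, neg_neg]

lemma rotate_mem_iff (T : Triangle (Stable P)) :
    T ∈ distinguished P ↔ T.rotate ∈ distinguished P := by
  refine ⟨rotate_mem, fun h => ?_⟩
  obtain ⟨T', hT', ⟨e⟩⟩ := exists_rotate_iso h
  exact distinguished_of_iso ((triangleRotation (Stable P)).functor.preimageIso e).symm hT'

lemma complete_cone {X Y Z X' Y' Z' : Stable P} {H : Hull P X.obj} {H' : Hull P X'.obj}
    {u : X.obj ⟶ Y.obj} {v : Y.obj ⟶ Z.obj} {w : Z.obj ⟶ H.Z} {k : H.I ⟶ Z.obj}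
    {u' : X'.obj ⟶ Y'.obj} {v' : Y'.obj ⟶ Z'.obj} {w' : Z'.obj ⟶ H'.Z} {k' : H'.I ⟶ Z'.obj}
    (hc : IsCone H u v w k) (hc' : IsCone H' u' v' w' k') (a : X ⟶ X') (b : Y ⟶ Y')
    (hab : (cls u : X ⟶ Y) ≫ b = a ≫ (cls u' : X' ⟶ Y')) :
    ∃ c : Z ⟶ Z', (cls v : Y ⟶ Z) ≫ c = b ≫ (cls v' : Y' ⟶ Z') ∧
      ((cls (Y := H.cosyz) w : Z ⟶ H.cosyz) ≫ (shiftHull H).hom) ≫ a⟦(1 : ℤ)⟧' =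
        c ≫ (cls (Y := H'.cosyz) w' : Z' ⟶ H'.cosyz) ≫ (shiftHull H').hom := by
  obtain ⟨a, rfl⟩ := cls_surj a
  obtain ⟨b, rfl⟩ := cls_surj b
  rw [← cls_comp, ← cls_comp, cls_eq_iff] at hab
  obtain ⟨Q, hQ, s, t, hst⟩ := hab
  obtain ⟨s', hs'⟩ := ((IsFrobenius.proj_iff_inj Q).1 hQ).ext _ H.confl s
  dsimp at s' hs'
  obtain ⟨ψ, φ, hφ, hψ⟩ := H.exists_rel H' a
  have ht := hc.total X.mem
  have e : biprod.lift u H.ι ≫ biprod.desc (b ≫ v') (-(φ ≫ k' + (s' ≫ t) ≫ v')) = 0 := by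
    rw [biprod.lift_desc, Preadditive.comp_neg, Preadditive.comp_add, ← assoc H.ι φ, hφ, assoc,
      hc'.comm₁, ← assoc, ← assoc H.ι, ← assoc H.ι, hs', hst, ← assoc, Preadditive.sub_comp]
    abel
  have := ht.exact.epi_g
  have h3 := ht.exact.exact.g_desc _ e
  set c := ht.exact.exact.desc _ e
  dsimp at c h3
  have h4 : v ≫ c = b ≫ v' := by
    have := congrArg (biprod.inl ≫ ·) h3
    simpa using this
  have h5 : k ≫ c = φ ≫ k' + (s' ≫ t) ≫ v' := by
    have := congrArg (biprod.inr ≫ ·) h3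
    simp only [biprod.inr_desc, biprod.inr_desc_assoc, Preadditive.neg_comp] at this
    exact neg_injective this
  refine ⟨cls c, ?_, ?_⟩
  · rw [← cls_comp, h4, cls_comp]
  · rw [assoc, ← shiftHull_naturality H H', cosyzMap_eq ⟨φ, hφ, hψ⟩, ← assoc, ← assoc]
    congr 1
    change cls (X := Z) (Y := H'.cosyz) (w ≫ ψ) = cls (X := Z) (Y := H'.cosyz) (c ≫ w')
    congr 1
    have epi : Epi (biprod.desc v (-k)) := ht.exact.epi_g
    rw [← cancel_epi (biprod.desc v (-k))]
    ext
    · simp only [biprod.inl_desc_assoc]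
      rw [← assoc, hc.zero, ← assoc, h4, assoc, hc'.zero, zero_comp, comp_zero]
    · simp only [biprod.inr_desc_assoc, Preadditive.neg_comp]
      rw [← assoc, hc.comm₂, ← assoc, h5, Preadditive.add_comp, assoc, assoc, hc'.zero, hc'.comm₂,
        comp_zero, add_zero, hψ]

lemma complete_of_iso {X₁ Y₁ Z₁ X₂ Y₂ Z₂ X Y Z X' Y' Z' : Stable P}
    {f₁ : X₁ ⟶ Y₁} {g₁ : Y₁ ⟶ Z₁} {h₁ : Z₁ ⟶ X₁⟦(1 : ℤ)⟧}
    {f₂ : X₂ ⟶ Y₂} {g₂ : Y₂ ⟶ Z₂} {h₂ : Z₂ ⟶ X₂⟦(1 : ℤ)⟧}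
    {f : X ⟶ Y} {g : Y ⟶ Z} {h : Z ⟶ X⟦(1 : ℤ)⟧}
    {f' : X' ⟶ Y'} {g' : Y' ⟶ Z'} {h' : Z' ⟶ X'⟦(1 : ℤ)⟧}
    (e₁ : X₁ ≅ X) (e₂ : Y₁ ≅ Y) (e₃ : Z₁ ≅ Z)
    (i₁ : f₁ ≫ e₂.hom = e₁.hom ≫ f) (i₂ : g₁ ≫ e₃.hom = e₂.hom ≫ g)
    (i₃ : h₁ ≫ e₁.hom⟦(1 : ℤ)⟧' = e₃.hom ≫ h)
    (e₁' : X₂ ≅ X') (e₂' : Y₂ ≅ Y') (e₃' : Z₂ ≅ Z')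
    (i₁' : f₂ ≫ e₂'.hom = e₁'.hom ≫ f') (i₂' : g₂ ≫ e₃'.hom = e₂'.hom ≫ g')
    (i₃' : h₂ ≫ e₁'.hom⟦(1 : ℤ)⟧' = e₃'.hom ≫ h')
    (H : ∀ (a : X ⟶ X') (b : Y ⟶ Y'), f ≫ b = a ≫ f' → ∃ c : Z ⟶ Z', g ≫ c = b ≫ g' ∧
      h ≫ a⟦(1 : ℤ)⟧' = c ≫ h')
    (a : X₁ ⟶ X₂) (b : Y₁ ⟶ Y₂) (hab : f₁ ≫ b = a ≫ f₂) :
    ∃ c : Z₁ ⟶ Z₂, g₁ ≫ c = b ≫ g₂ ∧ h₁ ≫ a⟦(1 : ℤ)⟧' = c ≫ h₂ := by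
  obtain ⟨c, h₃, h₄⟩ := H (e₁.inv ≫ a ≫ e₁'.hom) (e₂.inv ≫ b ≫ e₂'.hom) (by
    rw [← cancel_epi e₁.hom, ← assoc, ← i₁]
    simp only [assoc, Iso.hom_inv_id_assoc]
    rw [← assoc f₁, hab, assoc, i₁'])
  refine ⟨e₃.hom ≫ c ≫ e₃'.inv, ?_, ?_⟩
  · rw [← cancel_mono e₃'.hom]
    simp only [assoc, Iso.inv_hom_id, comp_id]
    rw [← assoc, i₂, assoc, h₃, i₂']
    simp
  · rw [← cancel_mono (e₁'.hom⟦(1 : ℤ)⟧')]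
    simp only [assoc]
    rw [i₃', Iso.inv_hom_id_assoc, ← h₄, ← assoc e₃.hom, ← i₃, assoc, ← Functor.map_comp,
      ← Functor.map_comp, Iso.hom_inv_id_assoc]

lemma complete_mem (T₁ T₂ : Triangle (Stable P)) (h₁ : T₁ ∈ distinguished P)
    (h₂ : T₂ ∈ distinguished P) (a : T₁.obj₁ ⟶ T₂.obj₁) (b : T₁.obj₂ ⟶ T₂.obj₂)
    (hab : T₁.mor₁ ≫ b = a ≫ T₂.mor₁) :
    ∃ c : T₁.obj₃ ⟶ T₂.obj₃, T₁.mor₂ ≫ c = b ≫ T₂.mor₂ ∧ T₁.mor₃ ≫ a⟦1⟧' = c ≫ T₂.mor₃ := by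
  obtain ⟨X, Y, Z, H, u, v, w, k, hc, ⟨e⟩⟩ := h₁
  obtain ⟨X', Y', Z', H', u', v', w', k', hc', ⟨e'⟩⟩ := h₂
  exact complete_of_iso (Triangle.π₁.mapIso e) (Triangle.π₂.mapIso e) (Triangle.π₃.mapIso e)
    e.hom.comm₁ e.hom.comm₂ e.hom.comm₃ (Triangle.π₁.mapIso e') (Triangle.π₂.mapIso e')
    (Triangle.π₃.mapIso e') e'.hom.comm₁ e'.hom.comm₂ e'.hom.comm₃ (complete_cone hc hc') a b hab

noncomputable instance : Pretriangulated (Stable P) where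
  distinguishedTriangles := distinguished P
  isomorphic_distinguished _ h _ e := distinguished_of_iso e h
  contractible_distinguished := contractible_mem
  distinguished_cocone_triangle := cocone_mem
  rotate_distinguished_triangle := rotate_mem_iff
  complete_distinguished_triangle_morphism := complete_mem

end Stable

end Frob

namespace Frob

universe v u

variable {𝒜 : Type u} [Category.{v} 𝒜] [Abelian 𝒜] {P : ObjectProperty 𝒜} [IsFrobenius P]

namespace Stable

open Pretriangulated Triangulated

/-- Up to isomorphism, a morphism of the stable category is an inflation. -/
lemma exists_inflation {X Y : Stable P} (f : X ⟶ Y) :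
    ∃ (Y' Z : Stable P) (e : Y ≅ Y') (u : X.obj ⟶ Y'.obj) (v : Y'.obj ⟶ Z.obj) (w : u ≫ v = 0),
      IsConflation P (ShortComplex.mk u v w) ∧ f ≫ e.hom = cls u := by
  obtain ⟨a, rfl⟩ := cls_surj f
  let H := X.hull
  obtain ⟨Z, v, w, k, hc⟩ := exists_isCone H a Y.mem
  let Y' : Stable P := ⟨Y.obj ⊞ H.I, prop_biprod P Y.mem H.proj.mem⟩
  refine ⟨Y', ⟨Z, hc.confl.mem₂⟩, (biprodIso Y H.proj).symm, biprod.lift a H.ι,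
    biprod.desc v (-k), _, hc.total X.mem, ?_⟩
  change cls (X := X) (Y := Y') (a ≫ biprod.inl) = cls (X := X) (Y := Y') (biprod.lift a H.ι)
  rw [cls_eq_iff]
  have : (a ≫ biprod.inl - biprod.lift a H.ι : X.obj ⟶ Y.obj ⊞ H.I) = H.ι ≫ (-biprod.inr) := by
    rw [biprod.lift_eq, Preadditive.comp_neg]
    abel
  rw [this]
  exact nullHom_intro H.proj _ _

/-- The conflation `Y/X ⟶ Z/X ⟶ Z/Y` of a composition of two inflations. -/
lemma exists_third {X Y Z A B : 𝒜} {u₁ : X ⟶ Y} {v₁ : Y ⟶ A} {w₁ : u₁ ≫ v₁ = 0}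
    {u₂ : Y ⟶ Z} {v₂ : Z ⟶ B} {w₂ : u₂ ≫ v₂ = 0}
    (h₁ : IsConflation P (ShortComplex.mk u₁ v₁ w₁))
    (h₂ : IsConflation P (ShortComplex.mk u₂ v₂ w₂)) :
    ∃ (D : 𝒜) (v : Z ⟶ D) (w : (u₁ ≫ u₂) ≫ v = 0) (m : A ⟶ D) (n : D ⟶ B) (z : m ≫ n = 0),
      IsConflation P (ShortComplex.mk (u₁ ≫ u₂) v w) ∧
      IsConflation P (ShortComplex.mk m n z) ∧ v₁ ≫ m = u₂ ≫ v ∧ v ≫ n = v₂ := by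
  have mono₁ : Mono u₁ := h₁.exact.mono_f
  have epi₁ : Epi v₁ := h₁.exact.epi_g
  have mono₂ : Mono u₂ := h₂.exact.mono_f
  have epi₂ : Epi v₂ := h₂.exact.epi_g
  have e₁ : u₁ ≫ u₂ ≫ cokernel.π (u₁ ≫ u₂) = 0 := by rw [← assoc, cokernel.condition]
  have hm := h₁.exact.exact.g_desc _ e₁
  set m := h₁.exact.exact.desc _ e₁
  dsimp at m hm
  have e₂ : (u₁ ≫ u₂) ≫ v₂ = 0 := by rw [assoc, w₂, comp_zero]
  have hn := cokernel.π_desc (u₁ ≫ u₂) v₂ e₂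
  set n := cokernel.desc (u₁ ≫ u₂) v₂ e₂
  have hmn : m ≫ n = 0 := by
    rw [← cancel_epi v₁, ← assoc, hm, assoc, hn, w₂, comp_zero]
  have hc : (ShortComplex.mk (u₁ ≫ u₂) (cokernel.π (u₁ ≫ u₂)) (cokernel.condition _)).ShortExact :=
    { exact := ShortComplex.exact_cokernel _
      mono_f := mono_comp _ _
      epi_g := by dsimp; infer_instance }
  have hex : (ShortComplex.mk m n hmn).ShortExact :=
    { epi_g := epi_of_epi_fac hn
      mono_f := by
        refine Preadditive.mono_of_cancel_zero _ (fun {W} t ht => ?_)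
        dsimp at t ht
        obtain ⟨W', e, he, y, hy⟩ := surjective_up_to_refinements_of_epi v₁ t
        have h3 : (y ≫ u₂) ≫ cokernel.π (u₁ ≫ u₂) = 0 := by
          rw [assoc, ← hm, ← assoc, ← hy, assoc, ht, comp_zero]
        have := hc.mono_f
        have h4 := hc.exact.lift_f _ h3
        set s := hc.exact.lift _ h3
        dsimp at s h4
        rw [← assoc] at h4
        have h5 := (cancel_mono u₂).1 h4
        rw [← cancel_epi e, hy, ← h5, assoc, w₁, comp_zero, comp_zero]
      exact := by
        rw [ShortComplex.exact_iff_exact_up_to_refinements]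
        intro W t ht
        dsimp at t ht
        obtain ⟨W', e, he, y, hy⟩ :=
          surjective_up_to_refinements_of_epi (cokernel.π (u₁ ≫ u₂)) t
        have h3 : y ≫ v₂ = 0 := by
          rw [← hn, ← assoc, ← hy, assoc, ht, comp_zero]
        have h4 := h₂.exact.exact.lift_f _ h3
        set s := h₂.exact.exact.lift _ h3
        dsimp at s h4
        refine ⟨W', e, he, s ≫ v₁, ?_⟩
        dsimp
        rw [hy, assoc, hm, ← assoc, h4] }
  have hD := P.prop_X₂_of_shortExact hex h₁.mem₃ h₂.mem₃
  exact ⟨_, _, _, m, n, hmn, ⟨hc, h₁.mem₁, h₂.mem₂, hD⟩, ⟨hex, h₁.mem₃, hD, h₂.mem₃⟩, hm, hn⟩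

instance : IsTriangulated (Stable P) := IsTriangulated.mk' (fun X₁ X₂' X₃' f g => by
  obtain ⟨X₂, Z₁₂, e₂, u₁, v₁, w₁, h₁, hf⟩ := exists_inflation f
  obtain ⟨X₃, Z₂₃, e₃, u₂, v₂, w₂, h₂, hg⟩ := exists_inflation (e₂.inv ≫ g)
  obtain ⟨D, v, w, m, n, z, h₁₃, hD, hm, hn⟩ := exists_third h₁ h₂
  let Z₁₃ : Stable P := ⟨D, hD.mem₂⟩
  obtain ⟨δ₁, hδ₁⟩ := exists_isConn X₁.hull h₁
  obtain ⟨δ₂, hδ₂⟩ := exists_isConn X₂.hull h₂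
  obtain ⟨δ₃, hδ₃⟩ := exists_isConn X₁.hull h₁₃
  obtain ⟨δ, hδ⟩ := exists_isConn Z₁₂.hull hD
  have c₁ := conflTriangle_mem h₁ hδ₁
  have c₂ := conflTriangle_mem h₂ hδ₂
  have c₃ := conflTriangle_mem (X := X₁) (Y := X₃) (Z := Z₁₃) h₁₃ hδ₃
  have c₄ := conflTriangle_mem (X := Z₁₂) (Y := Z₁₃) (Z := Z₂₃) hD hδ
  have n₁ := conn_naturality (X := X₁) (Y := X₂) (Z := Z₁₂) (X' := X₁) (Y' := X₃) (Z' := Z₁₃)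
    h₁ hδ₁ hδ₃ (α := 𝟙 _) (β := u₂) (γ := m) (by simp) hm
  have n₂ := conn_naturality (X := X₁) (Y := X₃) (Z := Z₁₃) (X' := X₂) (Y' := X₃) (Z' := Z₂₃)
    h₁₃ hδ₃ hδ₂ (α := u₁) (β := 𝟙 _) (γ := n) (by simp) (by simp [hn])
  have n₃ := conn_naturality (X := X₂) (Y := X₃) (Z := Z₂₃) (X' := Z₁₂) (Y' := Z₁₃) (Z' := Z₂₃)
    h₂ hδ₂ hδ (α := v₁) (β := v) (γ := 𝟙 _) hm.symm (by simp [hn])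
  rw [cls_id, CategoryTheory.Functor.map_id, comp_id] at n₁
  rw [cls_id, id_comp] at n₃
  refine ⟨X₁, X₂, X₃, Z₁₂, Z₂₃, Z₁₃, cls u₁, cls u₂, Iso.refl _, e₂, e₃, ?_, ?_, _, _, c₁, _, _, c₂,
    _, _, c₃, ⟨⟨cls m, cls n, ?_, ?_, ?_, ?_, ?_⟩⟩⟩
  · rw [hf, Iso.refl_hom, id_comp]
  · rw [← hg, assoc, Iso.hom_inv_id_assoc]
  · exact congrArg cls hm
  · rw [Preadditive.comp_neg, n₁]
  · exact congrArg cls hn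
  · rw [Preadditive.neg_comp, Preadditive.comp_neg, n₂]
  · rw [Preadditive.neg_comp, ← n₃]
    exact c₄)

end Stable

end Frob

/-! ### Cotorsion pairs, and the functors between the stable categories -/

namespace Frob

universe w v u

variable {𝒜 : Type u} [Category.{v} 𝒜] [Abelian 𝒜]

section

variable {P P' : ObjectProperty 𝒜} [IsFrobenius P] [IsFrobenius P']

/-- The functor between stable categories induced by an inclusion of Frobenius categories which
preserves projective objects. -/
noncomputable def Stable.incl (hle : P ≤ P') (hp : ∀ X, IsProj P X → IsProj P' X) :
    Stable P ⥤ Stable P' where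
  obj X := ⟨X.obj, hle _ X.mem⟩
  map {X Y} f := QuotientAddGroup.map (nullHom P X.obj Y.obj) (nullHom P' X.obj Y.obj)
    (AddMonoidHom.id _) (by
      rintro _ ⟨Q, hQ, a, b, rfl⟩
      exact ⟨Q, hp Q hQ, a, b, rfl⟩) f
  map_id X := rfl
  map_comp := by
    rintro X Y Z ⟨f⟩ ⟨g⟩
    rfl

end

variable [HasExt.{w} 𝒜]

open Abelian

/-- `(𝓐, 𝓑)` is a cotorsion pair in `𝓔`: each of the two classes is the `Ext¹`-orthogonal in `𝓔`
of the other. -/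
structure IsCotorsionPair (𝓔 𝓐 𝓑 : ObjectProperty 𝒜) : Prop where
  left_iff : ∀ X, 𝓐 X ↔ 𝓔 X ∧ ∀ Y, 𝓑 Y → Subsingleton (Ext.{w} X Y 1)
  right_iff : ∀ Y, 𝓑 Y ↔ 𝓔 Y ∧ ∀ X, 𝓐 X → Subsingleton (Ext.{w} X Y 1)

/-- All higher extension groups from `𝓐` to `𝓑` vanish. -/
def IsHereditary (𝓐 𝓑 : ObjectProperty 𝒜) : Prop :=
  ∀ (n : ℕ) (X Y : 𝒜), 0 < n → 𝓐 X → 𝓑 Y → Subsingleton (Ext.{w} X Y n)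

/-- A short exact sequence `0 ⟶ B ⟶ A ⟶ M ⟶ 0` with `A` in `𝓐` and `B` in `𝓑`. -/
structure RightApprox (𝓐 𝓑 : ObjectProperty 𝒜) (M : 𝒜) where
  (B A : 𝒜)
  (ι : B ⟶ A)
  (p : A ⟶ M)
  w : ι ≫ p = 0
  exact : (ShortComplex.mk ι p w).ShortExact
  hA : 𝓐 A
  hB : 𝓑 B

/-- A short exact sequence `0 ⟶ M ⟶ B ⟶ A ⟶ 0` with `A` in `𝓐` and `B` in `𝓑`. -/
structure LeftApprox (𝓐 𝓑 : ObjectProperty 𝒜) (M : 𝒜) where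
  (B A : 𝒜)
  (ι : M ⟶ B)
  (p : B ⟶ A)
  w : ι ≫ p = 0
  exact : (ShortComplex.mk ι p w).ShortExact
  hA : 𝓐 A
  hB : 𝓑 B

/-- Every object of `𝓔` has approximation sequences of both kinds. -/
structure IsComplete (𝓔 𝓐 𝓑 : ObjectProperty 𝒜) : Prop where
  right : ∀ M, 𝓔 M → Nonempty (RightApprox 𝓐 𝓑 M)
  left : ∀ M, 𝓔 M → Nonempty (LeftApprox 𝓐 𝓑 M)

/-- The standing assumptions: `𝓔` is an extension-closed subcategory, `(𝓐, 𝓑)` is a complete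
hereditary cotorsion pair in `𝓔`, the class `𝓒 ⊆ 𝓔` contains `𝓐` and is closed under extensions
and kernels of (admissible) epimorphisms of `𝓔`, the class `𝓓 ⊆ 𝓔` contains `𝓑` and is closed
under extensions and cokernels of (admissible) monomorphisms of `𝓔`, and the projective objects of
the exact categories `𝓐 ∩ 𝓓`, `𝓒 ∩ 𝓓` and `𝓒 ∩ 𝓑` are the objects of `𝓐 ∩ 𝓑`. -/
structure Setting (𝓔 𝓐 𝓑 𝓒 𝓓 : ObjectProperty 𝒜) : Prop where
  zero : 𝓔.ContainsZero
  ext : 𝓔.IsClosedUnderExtensions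
  cotorsion : IsCotorsionPair.{w} 𝓔 𝓐 𝓑
  hereditary : IsHereditary.{w} 𝓐 𝓑
  complete : IsComplete 𝓔 𝓐 𝓑
  A_le_C : 𝓐 ≤ 𝓒
  C_le_E : 𝓒 ≤ 𝓔
  C_ext : 𝓒.IsClosedUnderExtensions
  C_ker : ∀ S : ShortComplex 𝒜, IsConflation 𝓔 S → 𝓒 S.X₂ → 𝓒 S.X₃ → 𝓒 S.X₁
  B_le_D : 𝓑 ≤ 𝓓
  D_le_E : 𝓓 ≤ 𝓔
  D_ext : 𝓓.IsClosedUnderExtensions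
  D_coker : ∀ S : ShortComplex 𝒜, IsConflation 𝓔 S → 𝓓 S.X₁ → 𝓓 S.X₂ → 𝓓 S.X₃
  proj_AD : ∀ X, IsProj (𝓐 ⊓ 𝓓) X ↔ 𝓐 X ∧ 𝓑 X
  proj_CD : ∀ X, IsProj (𝓒 ⊓ 𝓓) X ↔ 𝓐 X ∧ 𝓑 X
  proj_CB : ∀ X, IsProj (𝓒 ⊓ 𝓑) X ↔ 𝓐 X ∧ 𝓑 X

lemma exists_lift_of_ext {S : ShortComplex 𝒜} (hS : S.ShortExact) {X : 𝒜}
    (hX : Subsingleton (Ext.{w} X S.X₁ 1)) (f : X ⟶ S.X₃) : ∃ g : X ⟶ S.X₂, g ≫ S.g = f := by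
  obtain ⟨g, hg⟩ := Ext.covariant_sequence_exact₃ X hS (Ext.mk₀ f) (zero_add 1)
    (Subsingleton.elim _ _)
  obtain ⟨g, rfl⟩ := Ext.addEquiv₀.symm.surjective g
  refine ⟨g, ?_⟩
  apply Ext.addEquiv₀.symm.injective
  simpa using hg

lemma exists_extension_of_ext {S : ShortComplex 𝒜} (hS : S.ShortExact) {Y : 𝒜}
    (hY : Subsingleton (Ext.{w} S.X₃ Y 1)) (f : S.X₁ ⟶ Y) : ∃ g : S.X₂ ⟶ Y, S.f ≫ g = f := by
  obtain ⟨g, hg⟩ := Ext.contravariant_sequence_exact₁ hS Y (Ext.mk₀ f) (add_zero 1)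
    (Subsingleton.elim _ _)
  obtain ⟨g, rfl⟩ := Ext.addEquiv₀.symm.surjective g
  refine ⟨g, ?_⟩
  apply Ext.addEquiv₀.symm.injective
  simpa using hg

namespace Setting

variable {𝓔 𝓐 𝓑 𝓒 𝓓 : ObjectProperty 𝒜}

lemma A_le_E (h : Setting.{w} 𝓔 𝓐 𝓑 𝓒 𝓓) : 𝓐 ≤ 𝓔 := fun _ hX => h.C_le_E _ (h.A_le_C _ hX)

lemma B_le_E (h : Setting.{w} 𝓔 𝓐 𝓑 𝓒 𝓓) : 𝓑 ≤ 𝓔 := fun _ hX => h.D_le_E _ (h.B_le_D _ hX)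

lemma orth (h : Setting.{w} 𝓔 𝓐 𝓑 𝓒 𝓓) {X Y : 𝒜} (hX : 𝓐 X) (hY : 𝓑 Y) :
    Subsingleton (Ext.{w} X Y 1) := ((h.cotorsion.left_iff X).1 hX).2 Y hY

lemma mem_right (h : Setting.{w} 𝓔 𝓐 𝓑 𝓒 𝓓) {M : 𝒜} (hM : (𝓒 ⊓ 𝓓) M)
    (S : RightApprox 𝓐 𝓑 M) : (𝓐 ⊓ 𝓓) S.A ∧ (𝓒 ⊓ 𝓑) S.B :=
  have := h.D_ext
  ⟨⟨S.hA, 𝓓.prop_X₂_of_shortExact S.exact (h.B_le_D _ S.hB) hM.2⟩,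
    ⟨h.C_ker _ ⟨S.exact, h.B_le_E _ S.hB, h.A_le_E _ S.hA, h.C_le_E _ hM.1⟩
      (h.A_le_C _ S.hA) hM.1, S.hB⟩⟩

lemma mem_left (h : Setting.{w} 𝓔 𝓐 𝓑 𝓒 𝓓) {M : 𝒜} (hM : (𝓒 ⊓ 𝓓) M)
    (S : LeftApprox 𝓐 𝓑 M) : (𝓐 ⊓ 𝓓) S.A ∧ (𝓒 ⊓ 𝓑) S.B :=
  have := h.C_ext
  ⟨⟨S.hA, h.D_coker _ ⟨S.exact, h.C_le_E _ hM.1, h.B_le_E _ S.hB, h.A_le_E _ S.hA⟩ hM.2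
      (h.B_le_D _ S.hB)⟩,
    ⟨𝓒.prop_X₂_of_shortExact S.exact hM.1 (h.A_le_C _ S.hA), S.hB⟩⟩

lemma exists_right (h : Setting.{w} 𝓔 𝓐 𝓑 𝓒 𝓓) {M M' : 𝒜} (S : RightApprox 𝓐 𝓑 M)
    (S' : RightApprox 𝓐 𝓑 M') (f : M ⟶ M') : ∃ g : S.A ⟶ S'.A, g ≫ S'.p = S.p ≫ f :=
  exists_lift_of_ext S'.exact (h.orth S.hA S'.hB) (S.p ≫ f)

lemma exists_left (h : Setting.{w} 𝓔 𝓐 𝓑 𝓒 𝓓) {M M' : 𝒜} (S : LeftApprox 𝓐 𝓑 M)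
    (S' : LeftApprox 𝓐 𝓑 M') (f : M ⟶ M') : ∃ g : S.B ⟶ S'.B, S.ι ≫ g = f ≫ S'.ι :=
  exists_extension_of_ext S.exact (h.orth S.hA S'.hB) (f ≫ S'.ι)

variable [IsFrobenius (𝓐 ⊓ 𝓓)] [IsFrobenius (𝓒 ⊓ 𝓓)] [IsFrobenius (𝓒 ⊓ 𝓑)]

lemma null_right (h : Setting.{w} 𝓔 𝓐 𝓑 𝓒 𝓓) {M M' : 𝒜} (hM' : (𝓒 ⊓ 𝓓) M')
    (S : RightApprox 𝓐 𝓑 M) (S' : RightApprox 𝓐 𝓑 M') {f : M ⟶ M'}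
    (hf : f ∈ nullHom (𝓒 ⊓ 𝓓) M M') {g : S.A ⟶ S'.A} (hg : g ≫ S'.p = S.p ≫ f) :
    g ∈ nullHom (𝓐 ⊓ 𝓓) S.A S'.A := by
  obtain ⟨Q, hQ, a, b, rfl⟩ := hf
  have hQ' := (h.proj_CD Q).1 hQ
  obtain ⟨β, hβ⟩ := exists_lift_of_ext S'.exact (h.orth hQ'.1 S'.hB) b
  dsimp at β hβ
  have e : (g - S.p ≫ a ≫ β) ≫ S'.p = 0 := by
    rw [Preadditive.sub_comp, hg, assoc, assoc, hβ, sub_self]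
  have := S'.exact.mono_f
  have h3 := S'.exact.exact.lift_f _ e
  set t := S'.exact.exact.lift _ e
  dsimp at t h3
  obtain ⟨K, L, i, p, w, hK, hL⟩ := IsFrobenius.enough_proj S'.B (h.mem_right hM' S').2
  obtain ⟨s, hs⟩ := exists_lift_of_ext hK.exact (h.orth S.hA hK.mem₁.2) t
  dsimp at s hs
  have : g = (S.p ≫ a) ≫ β + s ≫ p ≫ S'.ι := by
    rw [← assoc s, hs, h3, assoc]
    abel
  rw [this]
  exact add_mem (nullHom_intro ((h.proj_AD Q).2 hQ') _ _)
    (nullHom_intro ((h.proj_AD L).2 ((h.proj_CB L).1 hL)) _ _)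

lemma null_left (h : Setting.{w} 𝓔 𝓐 𝓑 𝓒 𝓓) {M M' : 𝒜} (hM : (𝓒 ⊓ 𝓓) M)
    (S : LeftApprox 𝓐 𝓑 M) (S' : LeftApprox 𝓐 𝓑 M') {f : M ⟶ M'}
    (hf : f ∈ nullHom (𝓒 ⊓ 𝓓) M M') {g : S.B ⟶ S'.B} (hg : S.ι ≫ g = f ≫ S'.ι) :
    g ∈ nullHom (𝓒 ⊓ 𝓑) S.B S'.B := by
  obtain ⟨Q, hQ, a, b, rfl⟩ := hf
  have hQ' := (h.proj_CD Q).1 hQ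
  obtain ⟨α, hα⟩ := exists_extension_of_ext S.exact (h.orth S.hA hQ'.2) a
  dsimp at α hα
  have e : S.ι ≫ (g - α ≫ b ≫ S'.ι) = 0 := by
    rw [Preadditive.comp_sub, hg, ← assoc S.ι, hα, assoc, sub_self]
  have := S.exact.epi_g
  have h3 := S.exact.exact.g_desc _ e
  set t := S.exact.exact.desc _ e
  dsimp at t h3
  obtain ⟨I, Z, i, p, w, hZ, hI⟩ := IsFrobenius.enough_inj S.A (h.mem_left hM S).1
  obtain ⟨s, hs⟩ := exists_extension_of_ext hZ.exact (h.orth hZ.mem₃.1 S'.hB) t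
  dsimp at s hs
  have : g = α ≫ b ≫ S'.ι + (S.p ≫ i) ≫ s := by
    rw [assoc, hs, h3]
    abel
  rw [this]
  refine add_mem (nullHom_intro ((h.proj_CB Q).2 hQ') _ _) (nullHom_intro ?_ _ _)
  exact (h.proj_CB I).2 ((h.proj_AD I).1 ((IsFrobenius.proj_iff_inj I).2 hI))

/-- The inclusion `i_*` of the stable category of `𝓐 ∩ 𝓓` into that of `𝓒 ∩ 𝓓`. -/
noncomputable def iLowerStar (h : Setting.{w} 𝓔 𝓐 𝓑 𝓒 𝓓) : Stable (𝓐 ⊓ 𝓓) ⥤ Stable (𝓒 ⊓ 𝓓) :=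
  Stable.incl (fun _ hX => ⟨h.A_le_C _ hX.1, hX.2⟩)
    (fun X hX => (h.proj_CD X).2 ((h.proj_AD X).1 hX))

/-- The inclusion `j_*` of the stable category of `𝓒 ∩ 𝓑` into that of `𝓒 ∩ 𝓓`. -/
noncomputable def jLowerStar (h : Setting.{w} 𝓔 𝓐 𝓑 𝓒 𝓓) : Stable (𝓒 ⊓ 𝓑) ⥤ Stable (𝓒 ⊓ 𝓓) :=
  Stable.incl (fun _ hX => ⟨hX.1, h.B_le_D _ hX.2⟩)
    (fun X hX => (h.proj_CD X).2 ((h.proj_CB X).1 hX))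

/-- The chosen short exact sequence `0 ⟶ B ⟶ A ⟶ M ⟶ 0`. -/
noncomputable def rightApprox (h : Setting.{w} 𝓔 𝓐 𝓑 𝓒 𝓓) (M : Stable (𝓒 ⊓ 𝓓)) :
    RightApprox 𝓐 𝓑 M.obj := (h.complete.right M.obj (h.C_le_E _ M.mem.1)).some

/-- The chosen short exact sequence `0 ⟶ M ⟶ B ⟶ A ⟶ 0`. -/
noncomputable def leftApprox (h : Setting.{w} 𝓔 𝓐 𝓑 𝓒 𝓓) (M : Stable (𝓒 ⊓ 𝓓)) :
    LeftApprox 𝓐 𝓑 M.obj := (h.complete.left M.obj (h.C_le_E _ M.mem.1)).some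

open Stable

/-- A morphism `f : M ⟶ M'` of `𝓒 ∩ 𝓓` representing the given class. -/
noncomputable def rep {M M' : Stable (𝓒 ⊓ 𝓓)} (f : M ⟶ M') : M.obj ⟶ M'.obj :=
  (cls_surj f).choose

lemma cls_rep {M M' : Stable (𝓒 ⊓ 𝓓)} (f : M ⟶ M') : cls (rep f) = f := (cls_surj f).choose_spec

lemma right_congr (h : Setting.{w} 𝓔 𝓐 𝓑 𝓒 𝓓) {M M' : Stable (𝓒 ⊓ 𝓓)}
    (S : RightApprox 𝓐 𝓑 M.obj) (S' : RightApprox 𝓐 𝓑 M'.obj) {f f' : M.obj ⟶ M'.obj}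
    (hf : (cls f : M ⟶ M') = cls f') {g g' : S.A ⟶ S'.A} (hg : g ≫ S'.p = S.p ≫ f)
    (hg' : g' ≫ S'.p = S.p ≫ f') :
    (cls (X := ⟨S.A, (h.mem_right M.mem S).1⟩) (Y := ⟨S'.A, (h.mem_right M'.mem S').1⟩) g) =
      cls g' := by
  rw [cls_eq_iff] at hf ⊢
  exact h.null_right M'.mem S S' hf (by rw [Preadditive.sub_comp, hg, hg', Preadditive.comp_sub])

lemma left_congr (h : Setting.{w} 𝓔 𝓐 𝓑 𝓒 𝓓) {M M' : Stable (𝓒 ⊓ 𝓓)}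
    (S : LeftApprox 𝓐 𝓑 M.obj) (S' : LeftApprox 𝓐 𝓑 M'.obj) {f f' : M.obj ⟶ M'.obj}
    (hf : (cls f : M ⟶ M') = cls f') {g g' : S.B ⟶ S'.B} (hg : S.ι ≫ g = f ≫ S'.ι)
    (hg' : S.ι ≫ g' = f' ≫ S'.ι) :
    (cls (X := ⟨S.B, (h.mem_left M.mem S).2⟩) (Y := ⟨S'.B, (h.mem_left M'.mem S').2⟩) g) =
      cls g' := by
  rw [cls_eq_iff] at hf ⊢
  exact h.null_left M.mem S S' hf (by rw [Preadditive.comp_sub, hg, hg', Preadditive.sub_comp])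

/-- The functor `i^!`, which maps `M` to the object `A` of the chosen short exact sequence
`0 ⟶ B ⟶ A ⟶ M ⟶ 0`, and the class of `f` to the class of any `g` such that `g ≫ p' = p ≫ f`. -/
noncomputable def iUpperShriek (h : Setting.{w} 𝓔 𝓐 𝓑 𝓒 𝓓) :
    Stable (𝓒 ⊓ 𝓓) ⥤ Stable (𝓐 ⊓ 𝓓) where
  obj M := ⟨(h.rightApprox M).A, (h.mem_right M.mem _).1⟩
  map {M M'} f := cls (X := ⟨_, _⟩) (Y := ⟨_, _⟩)
    (h.exists_right (h.rightApprox M) (h.rightApprox M') (rep f)).choose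
  map_id M := by
    rw [← cls_id]
    exact h.right_congr (h.rightApprox M) (h.rightApprox M) (cls_rep (𝟙 M))
      (h.exists_right _ _ _).choose_spec (g' := 𝟙 _) (by rw [id_comp, comp_id])
  map_comp {M M' M''} f g := by
    rw [← cls_comp]
    have e₁ := (h.exists_right (h.rightApprox M) (h.rightApprox M') (rep f)).choose_spec
    have e₂ := (h.exists_right (h.rightApprox M') (h.rightApprox M'') (rep g)).choose_spec
    refine h.right_congr (h.rightApprox M) (h.rightApprox M'') (f' := rep f ≫ rep g)
      ?_ (h.exists_right _ _ _).choose_spec ?_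
    · rw [cls_rep, cls_comp (Y := M'), cls_rep, cls_rep]
    · rw [assoc, e₂, ← assoc, e₁, assoc]

/-- The functor `j^*`, which maps `M` to the object `B` of the chosen short exact sequence
`0 ⟶ M ⟶ B ⟶ A ⟶ 0`, and the class of `f` to the class of any `g` such that `ι ≫ g = f ≫ ι'`. -/
noncomputable def jUpperStar (h : Setting.{w} 𝓔 𝓐 𝓑 𝓒 𝓓) :
    Stable (𝓒 ⊓ 𝓓) ⥤ Stable (𝓒 ⊓ 𝓑) where
  obj M := ⟨(h.leftApprox M).B, (h.mem_left M.mem _).2⟩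
  map {M M'} f := cls (X := ⟨_, _⟩) (Y := ⟨_, _⟩)
    (h.exists_left (h.leftApprox M) (h.leftApprox M') (rep f)).choose
  map_id M := by
    rw [← cls_id]
    exact h.left_congr (h.leftApprox M) (h.leftApprox M) (cls_rep (𝟙 M))
      (h.exists_left _ _ _).choose_spec (g' := 𝟙 _) (by rw [id_comp, comp_id])
  map_comp {M M' M''} f g := by
    rw [← cls_comp]
    have e₁ := (h.exists_left (h.leftApprox M) (h.leftApprox M') (rep f)).choose_spec
    have e₂ := (h.exists_left (h.leftApprox M') (h.leftApprox M'') (rep g)).choose_spec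
    refine h.left_congr (h.leftApprox M) (h.leftApprox M'') (f' := rep f ≫ rep g)
      ?_ (h.exists_left _ _ _).choose_spec ?_
    · rw [cls_rep, cls_comp (Y := M'), cls_rep, cls_rep]
    · rw [← assoc, e₁, assoc, e₂, assoc]

/-- The morphism `i_* i^! M ⟶ M` given by the chosen short exact sequence `0 ⟶ B ⟶ A ⟶ M ⟶ 0`. -/
noncomputable def rightApproxMap (h : Setting.{w} 𝓔 𝓐 𝓑 𝓒 𝓓) (M : Stable (𝓒 ⊓ 𝓓)) :
    h.iLowerStar.obj (h.iUpperShriek.obj M) ⟶ M :=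
  cls (X := h.iLowerStar.obj (h.iUpperShriek.obj M)) (Y := M) (h.rightApprox M).p

/-- The morphism `M ⟶ j_* j^* M` given by the chosen short exact sequence `0 ⟶ M ⟶ B ⟶ A ⟶ 0`. -/
noncomputable def leftApproxMap (h : Setting.{w} 𝓔 𝓐 𝓑 𝓒 𝓓) (M : Stable (𝓒 ⊓ 𝓓)) :
    M ⟶ h.jLowerStar.obj (h.jUpperStar.obj M) :=
  cls (X := M) (Y := h.jLowerStar.obj (h.jUpperStar.obj M)) (h.leftApprox M).ι

end Setting

end Frob

/-- A localization sequence `𝒯' ⟶ 𝒯 ⟶ 𝒯''` of triangulated categories: both functors are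
triangulated and have right adjoints, the composites `F^ρ F` and `G G^ρ` are identities (through
the unit and the counit), and the kernel of `G` consists of the objects isomorphic to some `F Y`. -/
structure IsLocalizationSequence {T₁ T₂ T₃ : Type*} [Category* T₁] [Category* T₂] [Category* T₃]
    [HasZeroObject T₁] [HasZeroObject T₂] [HasZeroObject T₃]
    [Preadditive T₁] [Preadditive T₂] [Preadditive T₃]
    [HasShift T₁ ℤ] [HasShift T₂ ℤ] [HasShift T₃ ℤ]
    [∀ n : ℤ, (shiftFunctor T₁ n).Additive] [∀ n : ℤ, (shiftFunctor T₂ n).Additive]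
    [∀ n : ℤ, (shiftFunctor T₃ n).Additive]
    [Pretriangulated T₁] [Pretriangulated T₂] [Pretriangulated T₃]
    {F : T₁ ⥤ T₂} {Fρ : T₂ ⥤ T₁} {G : T₂ ⥤ T₃} {Gρ : T₃ ⥤ T₂}
    [F.CommShift ℤ] [G.CommShift ℤ] (adjF : F ⊣ Fρ) (adjG : G ⊣ Gρ) : Prop where
  isTriangulated_left : F.IsTriangulated
  isTriangulated_right : G.IsTriangulated
  isIso_unit : IsIso adjF.unit
  isIso_counit : IsIso adjG.counit
  kernel : ∀ X, IsZero (G.obj X) ↔ F.essImage X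

universe v u

/-!
The inclusions `i_*` and `j_*` preserve projective-injective objects, conflations and hence the
pushouts which define the standard triangles, so they are triangulated. The shift by `ℤ` on a stable
category is induced by the suspension functor through sequences of objects
(`AutoShift.Orbit`); applying a functor degreewise to such sequences
(`AutoShift.Orbit.mapOrbit`) turns the commutation with the suspension into a commutation with the
shift, and `AutoShift.map_shiftOneIso_hom_app` recovers the suspension in degree one. Then
`Frob.Stable.incl_map_shiftHull_hom` gives the compatibility with the connecting morphisms of
standard triangles.

An object of `𝓐` is its own right approximation, so the uniqueness of lifts to right approximations
modulo projective objects gives the universal property of the counit of `i_* ⊣ i^!`; dually,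
`j^* ⊣ j_*`. Adjoints of triangulated functors are triangulated. The functors `i_*` and `j_*` are
fully faithful, because the projective objects of the three categories are the same.

If `j^* M` vanishes, then the middle term of `0 ⟶ M ⟶ B ⟶ A ⟶ 0` lies in `𝓐`, as a retract of an
object of `𝓐 ∩ 𝓑`, and `M` lies in `𝓐` since the cotorsion pair is hereditary; the converse holds as
`𝓐` is closed under extensions (`Frob.Setting.isZero_jUpperStar_obj_iff`). Finally, a left adjoint
of a fully faithful functor is a localization at the morphisms it inverts, and for a triangulated
functor these are the morphisms whose cone lies in the kernel; so `j^*` is a Verdier quotient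
(`CategoryTheory.exists_verdierQuotient_equivalence`).
-/

/-! ### Functors commuting with autoequivalences commute with the attached shifts -/

namespace AutoShift

variable {C D : Type*} [Category* C] [Category* D] {T : C ⥤ C} {T' : D ⥤ D} (F : C ⥤ D)
  (τ : T ⋙ F ≅ F ⋙ T')

namespace Orbit

/-- The functor between categories of sequences induced by a functor `F` and an isomorphism
between `T ⋙ F` and `F ⋙ T'`: apply `F` in each degree. -/
def mapOrbit : Orbit T ⥤ Orbit T' where
  obj A :=
    { X := fun n => F.obj (A.X n)
      iso := fun n m h => (τ.app (A.X n)).symm ≪≫ F.mapIso (A.iso n m h) }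
  map {A B} φ :=
    { f := fun n => F.map (φ.f n)
      comm := fun n m h => by
        have h1 : T'.map (F.map (φ.f n)) ≫ τ.inv.app (B.X n) =
          τ.inv.app (A.X n) ≫ F.map (T.map (φ.f n)) := τ.inv.naturality (φ.f n)
        change T'.map (F.map (φ.f n)) ≫ τ.inv.app (B.X n) ≫ F.map (B.iso n m h).hom =
          (τ.inv.app (A.X n) ≫ F.map (A.iso n m h).hom) ≫ F.map (φ.f m)
        rw [← assoc, h1, assoc, assoc, ← F.map_comp, ← F.map_comp, φ.comm] }
  map_id A := by ext n; exact F.map_id _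
  map_comp φ ψ := by ext n; exact F.map_comp _ _

lemma map_eqToHom_comp_eqToHom {a b : C} (p : a = b) (q : F.obj b = F.obj a) :
    F.map (eqToHom p) ≫ eqToHom q = 𝟙 _ := by
  subst p
  simp

lemma shiftFunctorZero_hom_f (A : Orbit T) (n : ℤ) :
    Hom.f ((shiftFunctorZero (Orbit T) ℤ).hom.app A) n = eqToHom (congrArg A.X (add_zero n)) := by
  rw [ShiftMkCore.shiftFunctorZero_eq]
  rfl

lemma shiftFunctorZero_inv_f (A : Orbit T) (n : ℤ) :
    Hom.f ((shiftFunctorZero (Orbit T) ℤ).inv.app A) n =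
      eqToHom (congrArg A.X (add_zero n).symm) := by
  rw [ShiftMkCore.shiftFunctorZero_eq]
  rfl

lemma shiftFunctorAdd_hom_f (a b : ℤ) (A : Orbit T) (n : ℤ) :
    Hom.f ((shiftFunctorAdd (Orbit T) a b).hom.app A) n =
      eqToHom (congrArg A.X (index_add n a b)) := by
  rw [ShiftMkCore.shiftFunctorAdd_eq]
  rfl

lemma shiftFunctorAdd_inv_f (a b : ℤ) (A : Orbit T) (n : ℤ) :
    Hom.f ((shiftFunctorAdd (Orbit T) a b).inv.app A) n =
      eqToHom (congrArg A.X (index_add n a b).symm) := by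
  rw [ShiftMkCore.shiftFunctorAdd_eq]
  rfl

/-- Applying `F` in each degree commutes strictly with reindexing. -/
instance : (mapOrbit F τ).CommShift ℤ where
  commShiftIso k := NatIso.ofComponents (fun A => Iso.refl _) (fun {A B} φ =>
    (comp_id ((mapOrbit F τ).map (φ⟦k⟧'))).trans
      (id_comp (((mapOrbit F τ).map φ)⟦k⟧')).symm)
  commShiftIso_zero := by
    ext A n
    rw [Functor.CommShift.isoZero_hom_app, comp_f, shiftFunctorZero_inv_f]
    change 𝟙 _ = F.map (Hom.f ((shiftFunctorZero (Orbit T) ℤ).hom.app A) n) ≫ _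
    rw [shiftFunctorZero_hom_f]
    exact (map_eqToHom_comp_eqToHom F (congrArg A.X (add_zero n)) _).symm
  commShiftIso_add a b := by
    ext A n
    rw [Functor.CommShift.isoAdd_hom_app, comp_f, comp_f, comp_f, shiftFunctorAdd_inv_f]
    change 𝟙 _ = F.map (Hom.f ((shiftFunctorAdd (Orbit T) a b).hom.app A) n) ≫
      𝟙 _ ≫ 𝟙 _ ≫ _
    rw [shiftFunctorAdd_hom_f]
    refine Eq.symm ((congrArg (F.map (eqToHom (congrArg A.X (index_add n a b))) ≫ ·)
      ((id_comp _).trans (id_comp _))).trans ?_)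
    exact map_eqToHom_comp_eqToHom F (congrArg A.X (index_add n a b)) _

lemma mapOrbit_commShiftIso_hom_app (k : ℤ) (A : Orbit T) :
    ((mapOrbit F τ).commShiftIso k).hom.app A = 𝟙 _ := rfl

variable [T.IsEquivalence] [T'.IsEquivalence]

/-- The object at index zero of the sequence attached to `X` is `X`. -/
noncomputable def evCounit (X : C) : ((ev T).inv.obj X).X 0 ≅ X :=
  (ev T).asEquivalence.counitIso.app X

lemma evCounit_naturality {X Y : C} (f : X ⟶ Y) :
    Hom.f ((ev T).inv.map f) 0 ≫ (evCounit Y).hom = (evCounit X).hom ≫ f :=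
  (ev T).asEquivalence.counitIso.hom.naturality f

lemma hom_ext_zero {A B : Orbit T} {φ ψ : A ⟶ B} (h : φ.f 0 = ψ.f 0) : φ = ψ :=
  (ev T).map_injective h

/-- The sequence attached to `F X` is obtained by applying `F` to the one attached to `X`. -/
noncomputable def invMapOrbitIsoApp (X : C) :
    (ev T').inv.obj (F.obj X) ≅ (mapOrbit F τ).obj ((ev T).inv.obj X) :=
  (ev T').preimageIso (X := (ev T').inv.obj (F.obj X))
    (Y := (mapOrbit F τ).obj ((ev T).inv.obj X))
    (evCounit (T := T') (F.obj X) ≪≫ F.mapIso (evCounit (T := T) X).symm)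

lemma invMapOrbitIsoApp_hom_f_zero (X : C) : Hom.f (invMapOrbitIsoApp F τ X).hom 0 =
    (evCounit (T := T') (F.obj X)).hom ≫ F.map (evCounit (T := T) X).inv :=
  (ev T').map_preimage _

lemma invMapOrbitIsoApp_inv_f_zero (X : C) : Hom.f (invMapOrbitIsoApp F τ X).inv 0 =
    F.map (evCounit (T := T) X).hom ≫ (evCounit (T := T') (F.obj X)).inv :=
  (ev T').map_preimage _

/-- Evaluation of sequences at zero intertwines `mapOrbit F τ` with `F`, hence so do the
quasi-inverses of the evaluations. -/
noncomputable def invMapOrbitIso : F ⋙ (ev T').inv ≅ (ev T).inv ⋙ mapOrbit F τ :=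
  NatIso.ofComponents (invMapOrbitIsoApp F τ) (fun {X Y} f => by
    apply hom_ext_zero
    change Hom.f ((ev T').inv.map (F.map f)) 0 ≫ Hom.f (invMapOrbitIsoApp F τ Y).hom 0 =
      Hom.f (invMapOrbitIsoApp F τ X).hom 0 ≫ F.map (Hom.f ((ev T).inv.map f) 0)
    rw [invMapOrbitIsoApp_hom_f_zero, invMapOrbitIsoApp_hom_f_zero]
    have h1 : Hom.f ((ev T').inv.map (F.map f)) 0 ≫ (evCounit (F.obj Y)).hom ≫
        F.map (evCounit (T := T) Y).inv = ((evCounit (F.obj X)).hom ≫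
          F.map (evCounit (T := T) X).inv) ≫ F.map (Hom.f ((ev T).inv.map f) 0) := by
      rw [← assoc, evCounit_naturality, assoc, assoc, ← F.map_comp, ← F.map_comp]
      congr 2
      rw [Iso.eq_inv_comp, ← assoc, ← evCounit_naturality, assoc, Iso.hom_inv_id, comp_id]
    exact h1)

end Orbit

variable [T.IsEquivalence] [T'.IsEquivalence]

/-- The quasi-inverse of the evaluation at zero commutes with the shifts: the shift of `C` is
induced by it. -/
@[reducible]
noncomputable def commShiftEvInv :
    letI := hasShift T
    (Orbit.ev T).inv.CommShift ℤ :=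
  Functor.CommShift.ofHasShiftOfFullyFaithful _ _ _

/-- A functor which commutes with `T` and `T'` commutes with the `ℤ`-shifts attached to them. -/
@[reducible]
noncomputable def commShift :
    letI := hasShift T
    letI := hasShift T'
    F.CommShift ℤ :=
  letI := hasShift T
  letI := hasShift T'
  letI := commShiftEvInv (T := T)
  letI := commShiftEvInv (T := T')
  Functor.CommShift.ofComp (Orbit.invMapOrbitIso F τ) ℤ

open Orbit

/-- At index zero, the commutation of the quasi-inverse of the evaluation with the shift by `k` is
the counit: both sides have the object at index `k` of the sequence attached to `X` as target. -/
lemma evCounit_comp_shift (k : ℤ) (X : C) :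
    letI := hasShift T
    letI := commShiftEvInv (T := T)
    Hom.f (((ev T).inv.commShiftIso k).hom.app X) 0 = (evCounit (T := T) (X⟦k⟧)).hom :=
  ((ev T).asEquivalence.counit_app_functor (((ev T).inv.obj X)⟦k⟧)).symm

/-- The commutation with the shift by `k` is the component at index `k` of the identification of
the sequence attached to `F X` with the image under `F` of the one attached to `X`. -/
lemma commShift_hom_app (k : ℤ) (X : C) :
    letI := hasShift T
    letI := hasShift T'
    letI := commShift F τ
    (F.commShiftIso k).hom.app X = Hom.f (invMapOrbitIsoApp F τ X).inv (0 + k) := by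
  let := hasShift T
  let := hasShift T'
  let := commShiftEvInv (T := T)
  let := commShiftEvInv (T := T')
  let := commShift F τ
  have h1 : (ev T').inv.map ((F.commShiftIso k).hom.app X) ≫
        ((ev T').inv.commShiftIso k).hom.app (F.obj X) =
      (invMapOrbitIsoApp F τ (X⟦k⟧)).hom ≫
        (mapOrbit F τ).map (((ev T).inv.commShiftIso k).hom.app X) ≫
          (invMapOrbitIsoApp F τ X).inv⟦k⟧' := by
    have h := Functor.CommShift.OfComp.map_iso_hom_app (invMapOrbitIso F τ) k X
    refine (congrArg (· ≫ ((ev T').inv.commShiftIso k).hom.app (F.obj X)) h).trans ?_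
    simp only [assoc, Iso.inv_hom_id_app]
    refine congrArg ((invMapOrbitIsoApp F τ (X⟦k⟧)).hom ≫ ·) ?_
    rw [Functor.commShiftIso_comp_hom_app, mapOrbit_commShiftIso_hom_app]
    exact congrArg₂ (· ≫ ·) (comp_id ((mapOrbit F τ).map (((ev T).inv.commShiftIso k).hom.app X)))
      (comp_id ((invMapOrbitIsoApp F τ X).inv⟦k⟧'))
  -- At index zero, all factors except the last one are counits, which cancel.
  have h2 := congrArg (fun φ => Hom.f φ 0) h1
  change Hom.f ((ev T').inv.map ((F.commShiftIso k).hom.app X)) 0 ≫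
    Hom.f (((ev T').inv.commShiftIso k).hom.app (F.obj X)) 0 =
      Hom.f (invMapOrbitIsoApp F τ (X⟦k⟧)).hom 0 ≫
        F.map (Hom.f (((ev T).inv.commShiftIso k).hom.app X) 0) ≫
          Hom.f (invMapOrbitIsoApp F τ X).inv (0 + k) at h2
  rw [evCounit_comp_shift, evCounit_comp_shift, invMapOrbitIsoApp_hom_f_zero] at h2
  have h3 : ∀ g y : F.obj (X⟦k⟧) ⟶ (F.obj X)⟦k⟧,
      Hom.f ((ev T').inv.map g) 0 ≫ (evCounit (T := T') ((F.obj X)⟦k⟧)).hom =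
        ((evCounit (T := T') (F.obj (X⟦k⟧))).hom ≫ F.map (evCounit (T := T) (X⟦k⟧)).inv) ≫
          F.map (evCounit (T := T) (X⟦k⟧)).hom ≫ y → g = y := by
    intro g y h
    rw [evCounit_naturality, assoc, ← assoc (F.map _), ← F.map_comp, Iso.inv_hom_id, F.map_id,
      id_comp] at h
    exact (cancel_epi _).1 h
  exact h3 _ _ h2

/-- Up to the identifications of the shifts by `1` with `T` and `T'`, the given isomorphism is
the commutation isomorphism with the shift by `1`. -/
lemma map_shiftOneIso_hom_app (X : C) :
    letI := hasShift T
    letI := hasShift T'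
    letI := commShift F τ
    F.map ((shiftOneIso T).hom.app X) ≫ τ.hom.app X =
      (F.commShiftIso (1 : ℤ)).hom.app X ≫ (shiftOneIso T').hom.app (F.obj X) := by
  rw [commShift_hom_app]
  -- Compatibility of a morphism of sequences with the step from index zero to index one.
  have h := (invMapOrbitIsoApp F τ X).inv.comm 0 (0 + 1) rfl
  rw [invMapOrbitIsoApp_inv_f_zero] at h
  have key : ∀ y : F.obj (((ev T).inv.obj X).X (0 + 1)) ⟶ ((ev T').inv.obj (F.obj X)).X (0 + 1),
      T'.map (F.map (evCounit (T := T) X).hom ≫ (evCounit (T := T') (F.obj X)).inv) ≫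
        (((ev T').inv.obj (F.obj X)).iso 0 (0 + 1) rfl).hom =
        (τ.inv.app (((ev T).inv.obj X).X 0) ≫
          F.map (((ev T).inv.obj X).iso 0 (0 + 1) rfl).hom) ≫ y →
      F.map ((((ev T).inv.obj X).iso 0 (0 + 1) rfl).inv ≫ T.map (evCounit X).hom) ≫
        τ.hom.app X =
      y ≫ (((ev T').inv.obj (F.obj X)).iso 0 (0 + 1) rfl).inv ≫
        T'.map (evCounit (F.obj X)).hom := by
    intro y hy
    have h1 : F.map (T.map (evCounit (T := T) X).hom) ≫ τ.hom.app X =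
        τ.hom.app (((ev T).inv.obj X).X 0) ≫ T'.map (F.map (evCounit (T := T) X).hom) :=
      τ.hom.naturality _
    have h2 : y = F.map (((ev T).inv.obj X).iso 0 (0 + 1) rfl).inv ≫
        τ.hom.app (((ev T).inv.obj X).X 0) ≫
        T'.map (F.map (evCounit (T := T) X).hom ≫ (evCounit (T := T') (F.obj X)).inv) ≫
        (((ev T').inv.obj (F.obj X)).iso 0 (0 + 1) rfl).hom := by
      rw [hy, assoc, ← assoc (τ.hom.app _), Iso.hom_inv_id_app]
      simp [← F.map_comp_assoc]
    rw [F.map_comp, assoc, h1, h2]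
    simp only [assoc, Iso.hom_inv_id_assoc, ← T'.map_comp, Iso.inv_hom_id, comp_id]
  exact key _ h

end AutoShift

/-! ### Inclusions of Frobenius categories induce triangulated functors -/

namespace Frob

variable {𝒜 : Type u} [Category.{v} 𝒜] [Abelian 𝒜] {P P' : ObjectProperty 𝒜}

lemma IsConflation.mono {S : ShortComplex 𝒜} (h : IsConflation P S) (hle : P ≤ P') :
    IsConflation P' S :=
  ⟨h.exact, hle _ h.mem₁, hle _ h.mem₂, hle _ h.mem₃⟩

variable [IsFrobenius P] [IsFrobenius P'] (hle : P ≤ P') (hp : ∀ X, IsProj P X → IsProj P' X)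

/-- A hull in `P` is a hull in `P'`. -/
def Hull.incl {M : 𝒜} (H : Hull P M) : Hull P' M where
  I := H.I
  Z := H.Z
  ι := H.ι
  π := H.π
  w := H.w
  confl := H.confl.mono hle
  proj := hp _ H.proj

lemma Hull.Rel.incl {M N : 𝒜} {H : Hull P M} {H' : Hull P N} {f : M ⟶ N} {ψ : H.Z ⟶ H'.Z}
    (h : H.Rel H' f ψ) : (H.incl hle hp).Rel (H'.incl hle hp) f ψ := h

lemma IsCone.incl {X Y Z : 𝒜} {H : Hull P X} {u : X ⟶ Y} {v : Y ⟶ Z} {w : Z ⟶ H.Z}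
    {k : H.I ⟶ Z} (h : IsCone H u v w k) : IsCone (H.incl hle hp) u v w k :=
  ⟨h.zero, h.confl.mono hle, h.comm₁, h.comm₂⟩

namespace Stable

instance : (incl hle hp).Full where
  map_surjective {X Y} f := by
    obtain ⟨f, rfl⟩ := cls_surj f
    exact ⟨cls (X := X) (Y := Y) f, rfl⟩

lemma incl_faithful (hp' : ∀ X, IsProj P' X → IsProj P X) : (incl hle hp).Faithful where
  map_injective {X Y f g} h := by
    obtain ⟨f, rfl⟩ := cls_surj f
    obtain ⟨g, rfl⟩ := cls_surj g
    rw [cls_eq_iff]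
    obtain ⟨Q, hQ, a, b, e⟩ := (cls_eq_iff (X := (incl hle hp).obj X)
      (Y := (incl hle hp).obj Y) f g).1 h
    exact ⟨Q, hp' Q hQ, a, b, e⟩

lemma incl_map_cosyzMap {X Y : Stable P} (H : Hull P X.obj) (H' : Hull P Y.obj) (f : X ⟶ Y) :
    (incl hle hp).map (cosyzMap H H' f) =
      cosyzMap (X := (incl hle hp).obj X) (Y := (incl hle hp).obj Y)
        (H.incl hle hp) (H'.incl hle hp) ((incl hle hp).map f) := by
  obtain ⟨f, rfl⟩ := cls_surj f
  obtain ⟨ψ, h⟩ := H.exists_rel H' f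
  rw [cosyzMap_eq h]
  exact (cosyzMap_eq (X := (incl hle hp).obj X) (Y := (incl hle hp).obj Y)
    (h.incl hle hp)).symm

/-- The inclusion commutes with the suspension functors. -/
noncomputable def suspInclIso : susp P ⋙ incl hle hp ≅ incl hle hp ⋙ susp P' :=
  NatIso.ofComponents
    (fun X => cosyzIso (X := (incl hle hp).obj X) (X.hull.incl hle hp) ((incl hle hp).obj X).hull)
    (fun {X Y} f => by
      have h := (incl_map_cosyzMap hle hp X.hull Y.hull f)
      refine (congrArg (· ≫ cosyzMap (X := (incl hle hp).obj Y) (Y := (incl hle hp).obj Y)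
        (Y.hull.incl hle hp) ((incl hle hp).obj Y).hull (𝟙 _)) h).trans ?_
      refine (cosyzMap_comp (X := (incl hle hp).obj X) (Y := (incl hle hp).obj Y)
        (Z := (incl hle hp).obj Y) (X.hull.incl hle hp) (Y.hull.incl hle hp)
        ((incl hle hp).obj Y).hull ((incl hle hp).map f) (𝟙 _)).symm.trans ?_
      refine Eq.trans ?_ (cosyzMap_comp (X := (incl hle hp).obj X) (Y := (incl hle hp).obj X)
        (Z := (incl hle hp).obj Y) (X.hull.incl hle hp) ((incl hle hp).obj X).hull
        ((incl hle hp).obj Y).hull (𝟙 _) ((incl hle hp).map f))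
      rw [comp_id, id_comp])

noncomputable instance : (incl hle hp).CommShift ℤ :=
  AutoShift.commShift (incl hle hp) (suspInclIso hle hp)

lemma incl_map_shiftIso_hom_app (X : Stable P) :
    (incl hle hp).map (shiftIso.hom.app X) ≫ (suspInclIso hle hp).hom.app X =
      ((incl hle hp).commShiftIso (1 : ℤ)).hom.app X ≫ shiftIso.hom.app ((incl hle hp).obj X) :=
  AutoShift.map_shiftOneIso_hom_app (incl hle hp) (suspInclIso hle hp) X

/-- The inclusion is compatible with the identifications of cosyzygies with shifts; this is what
determines the third morphism of the image of a standard triangle. -/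
lemma incl_map_shiftHull_hom {X : Stable P} (H : Hull P X.obj) :
    (incl hle hp).map (shiftHull H).hom ≫ ((incl hle hp).commShiftIso (1 : ℤ)).hom.app X =
      (shiftHull (X := (incl hle hp).obj X) (H.incl hle hp)).hom := by
  have h1 : (incl hle hp).map (shiftIso.inv.app X) ≫
      ((incl hle hp).commShiftIso (1 : ℤ)).hom.app X =
      (suspInclIso hle hp).hom.app X ≫ shiftIso.inv.app ((incl hle hp).obj X) := by
    rw [← cancel_epi ((incl hle hp).map (shiftIso.hom.app X)), ← assoc, ← assoc,
      incl_map_shiftIso_hom_app, ← Functor.map_comp]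
    simp
  have h2 : (shiftHull H).hom = cosyzMap H X.hull (𝟙 X) ≫ shiftIso.inv.app X := rfl
  have h3 : (shiftHull (X := (incl hle hp).obj X) (H.incl hle hp)).hom =
    cosyzMap (H.incl hle hp) ((incl hle hp).obj X).hull (𝟙 ((incl hle hp).obj X)) ≫
      shiftIso.inv.app ((incl hle hp).obj X) := rfl
  have h4 : (incl hle hp).map (cosyzMap H X.hull (𝟙 X)) ≫ (suspInclIso hle hp).hom.app X =
      cosyzMap (H.incl hle hp) ((incl hle hp).obj X).hull (𝟙 ((incl hle hp).obj X)) := by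
    rw [incl_map_cosyzMap]
    refine (congrArg (fun φ => cosyzMap (X := (incl hle hp).obj X) (Y := (incl hle hp).obj X)
      (H.incl hle hp) (X.hull.incl hle hp) φ ≫ (suspInclIso hle hp).hom.app X)
      ((incl hle hp).map_id X)).trans ?_
    refine (cosyzMap_comp (X := (incl hle hp).obj X) (Y := (incl hle hp).obj X)
        (Z := (incl hle hp).obj X) (H.incl hle hp) (X.hull.incl hle hp)
        ((incl hle hp).obj X).hull (𝟙 _) (𝟙 _)).symm.trans ?_
    rw [comp_id]
  rw [h2, h3, ← h4]
  refine (congrArg (· ≫ ((incl hle hp).commShiftIso (1 : ℤ)).hom.app X)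
    ((incl hle hp).map_comp (cosyzMap H X.hull (𝟙 X)) (shiftIso.inv.app X))).trans ?_
  refine (assoc _ _ _).trans (Eq.trans ?_ (assoc _ _ _).symm)
  exact congrArg ((incl hle hp).map (cosyzMap H X.hull (𝟙 X)) ≫ ·) h1

open Pretriangulated in
/-- The inclusion is triangulated, because a standard triangle of `P` is also one of `P'`. -/
instance : (incl hle hp).IsTriangulated where
  map_distinguished T hT := by
    obtain ⟨X, Y, Z, H, u, v, w, k, hc, ⟨e⟩⟩ := hT
    refine isomorphic_distinguished _ (IsCone.mem (X := (incl hle hp).obj X)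
      (Y := (incl hle hp).obj Y) (Z := (incl hle hp).obj Z) (hc.incl hle hp)) _
      ((incl hle hp).mapTriangle.mapIso e ≪≫ ?_)
    refine triIso (Iso.refl _) (Iso.refl _) (Iso.refl _) ?_ ?_ ?_
    · exact (comp_id _).trans (id_comp _).symm
    · exact (comp_id _).trans (id_comp _).symm
    · refine Eq.trans ?_ (id_comp _).symm
      refine (congrArg (((incl hle hp).mapTriangle.obj (triangle H u v w)).mor₃ ≫ ·)
        (CategoryTheory.Functor.map_id _ _)).trans ((comp_id _).trans ?_)
      refine (congrArg (· ≫ ((incl hle hp).commShiftIso (1 : ℤ)).hom.app X)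
        ((incl hle hp).map_comp (cls (Y := H.cosyz) w : Z ⟶ H.cosyz) (shiftHull H).hom)).trans ?_
      refine (assoc _ _ _).trans ?_
      exact congrArg ((incl hle hp).map (cls (Y := H.cosyz) w : Z ⟶ H.cosyz) ≫ ·)
        (incl_map_shiftHull_hom hle hp H)

/-- The stably zero objects are the retracts of projective objects. -/
lemma isZero_iff_isProj_factor (X : Stable P) : IsZero X ↔
    ∃ (Q : 𝒜) (_ : IsProj P Q) (a : X.obj ⟶ Q) (b : Q ⟶ X.obj), a ≫ b = 𝟙 X.obj := by
  rw [IsZero.iff_id_eq_zero, ← cls_id, cls_eq_zero_iff, mem_nullHom_iff]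

lemma isZero_of_isProj {X : Stable P} (hX : IsProj P X.obj) : IsZero X :=
  X.isZero_iff_isProj_factor.2 ⟨_, hX, 𝟙 _, 𝟙 _, comp_id _⟩

end Stable

end Frob

/-! ### Adjunctions from universal arrows, and Verdier quotients from adjunctions -/

namespace CategoryTheory

namespace Adjunction

variable {C D : Type*} [Category* C] [Category* D] {L : C ⥤ D} {R : D ⥤ C}

/-- An adjunction from a natural family of morphisms `L (R M) ⟶ M` with the universal property
of a counit. -/
noncomputable def ofCounit (ε : ∀ M, L.obj (R.obj M) ⟶ M)
    (nat : ∀ {M M'} (f : M ⟶ M'), L.map (R.map f) ≫ ε M' = ε M ≫ f)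
    (bij : ∀ N M, Function.Bijective (fun g : N ⟶ R.obj M => L.map g ≫ ε M)) : L ⊣ R :=
  mkOfHomEquiv
    { homEquiv := fun N M => (Equiv.ofBijective _ (bij N M)).symm
      homEquiv_naturality_left_symm := by simp
      homEquiv_naturality_right := fun {N M M'} f g => by
        apply (Equiv.ofBijective _ (bij N M')).injective
        rw [Equiv.apply_symm_apply]
        have h := (Equiv.ofBijective _ (bij N M)).apply_symm_apply f
        rw [Equiv.ofBijective_apply] at h ⊢
        rw [L.map_comp, assoc, nat, ← assoc, h] }

lemma ofCounit_counit_app (ε : ∀ M, L.obj (R.obj M) ⟶ M)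
    (nat : ∀ {M M'} (f : M ⟶ M'), L.map (R.map f) ≫ ε M' = ε M ≫ f)
    (bij : ∀ N M, Function.Bijective (fun g : N ⟶ R.obj M => L.map g ≫ ε M)) (M : D) :
    (ofCounit ε nat bij).counit.app M = ε M := by
  simp [ofCounit]

/-- An adjunction from a natural family of morphisms `M ⟶ R (L M)` with the universal property
of a unit. -/
noncomputable def ofUnit (η : ∀ M, M ⟶ R.obj (L.obj M))
    (nat : ∀ {M M'} (f : M ⟶ M'), f ≫ η M' = η M ≫ R.map (L.map f))
    (bij : ∀ M N, Function.Bijective (fun g : L.obj M ⟶ N => η M ≫ R.map g)) : L ⊣ R :=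
  mkOfHomEquiv
    { homEquiv := fun M N => Equiv.ofBijective _ (bij M N)
      homEquiv_naturality_left_symm := fun {M M' N} f g => by
        apply (Equiv.ofBijective _ (bij M N)).injective
        rw [Equiv.apply_symm_apply]
        have h := (Equiv.ofBijective _ (bij M' N)).apply_symm_apply g
        rw [Equiv.ofBijective_apply] at h ⊢
        rw [R.map_comp, ← assoc, ← nat, assoc, h]
      homEquiv_naturality_right := by simp }

lemma ofUnit_unit_app (η : ∀ M, M ⟶ R.obj (L.obj M))
    (nat : ∀ {M M'} (f : M ⟶ M'), f ≫ η M' = η M ≫ R.map (L.map f))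
    (bij : ∀ M N, Function.Bijective (fun g : L.obj M ⟶ N => η M ≫ R.map g)) (M : C) :
    (ofUnit η nat bij).unit.app M = η M := by
  simp [ofUnit]

end Adjunction

section

open Pretriangulated Triangulated

variable {C D : Type*} [Category* C] [Category* D] [HasZeroObject C] [HasZeroObject D]
  [Preadditive C] [Preadditive D] [HasShift C ℤ] [HasShift D ℤ]
  [∀ n : ℤ, (shiftFunctor C n).Additive] [∀ n : ℤ, (shiftFunctor D n).Additive]
  [Pretriangulated C] [Pretriangulated D]
  (G : C ⥤ D) [G.CommShift ℤ] [G.IsTriangulated]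
  (K : ObjectProperty C) [K.IsClosedUnderIsomorphisms] (hK : ∀ X, IsZero (G.obj X) ↔ K X)

include hK in
/-- A triangulated functor inverts a morphism if and only if it sends its cone to zero. -/
lemma trW_eq_inverseImage_isomorphisms :
    K.trW = (MorphismProperty.isomorphisms D).inverseImage G := by
  ext X Y f
  obtain ⟨Z, g, h, mem⟩ := distinguished_cocone_triangle f
  exact (K.trW_iff_of_distinguished (Triangle.mk f g h) mem).trans ((hK Z).symm.trans
    (Triangle.isZero₃_iff_isIso₁ _ (G.map_distinguished _ mem)))

include hK in
/-- A triangulated functor with kernel `K` and a fully faithful right adjoint is a Verdier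
quotient by `K`. -/
theorem exists_verdierQuotient_equivalence [IsTriangulated C] [K.IsTriangulated]
    {Gρ : D ⥤ C} (adj : G ⊣ Gρ) [Gρ.Full] [Gρ.Faithful] :
    ∃ (Φ : K.trW.Localization ⥤ D) (_ : Φ.CommShift ℤ) (e : K.trW.Q ⋙ Φ ≅ G),
      Φ.IsTriangulated ∧ Φ.IsEquivalence ∧ NatTrans.CommShift e.hom ℤ := by
  have hG : G.IsLocalization K.trW := by
    rw [trW_eq_inverseImage_isomorphisms G K hK]
    exact adj.isLocalization
  let Φ : K.trW.Localization ⥤ D := 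
    Localization.Construction.lift G (Localization.inverts G K.trW)
  let : Localization.Lifting K.trW.Q K.trW G Φ :=
    ⟨eqToIso (Localization.Construction.fac G (Localization.inverts G K.trW))⟩
  let : Φ.CommShift ℤ := Functor.commShiftOfLocalization K.trW.Q K.trW ℤ G Φ
  let e : K.trW.Q ⋙ Φ ≅ G := Localization.Lifting.iso K.trW.Q K.trW G Φ
  have he : NatTrans.CommShift e.hom ℤ :=
    NatTrans.commShift_iso_hom_of_localization K.trW.Q K.trW ℤ G Φ
  have := Localization.essSurj_mapArrow K.trW.Q K.trW
  exact ⟨Φ, inferInstance, e, Functor.isTriangulated_of_precomp_iso e, hG.isEquivalence, he⟩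

end

end CategoryTheory

/-! ### Closure properties of the left class of a hereditary cotorsion pair -/

universe w

namespace Frob

variable {𝒜 : Type u} [Category.{v} 𝒜] [Abelian 𝒜] [HasExt.{w} 𝒜]

open Abelian

lemma subsingleton_ext_of_retract {X Q Y : 𝒜} {n : ℕ} (a : X ⟶ Q) (b : Q ⟶ X) (e : a ≫ b = 𝟙 X)
    (hQ : Subsingleton (Ext.{w} Q Y n)) : Subsingleton (Ext.{w} X Y n) := by
  refine subsingleton_of_forall_eq 0 (fun x => ?_)
  have h : (Ext.mk₀ b).comp x (zero_add n) = 0 := Subsingleton.elim _ _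
  rw [← Ext.mk₀_id_comp x, ← e, ← Ext.mk₀_comp_mk₀_assoc, h, Ext.comp_zero]

lemma subsingleton_ext_left {S : ShortComplex 𝒜} (hS : S.ShortExact) {Y : 𝒜} {n : ℕ}
    (h₂ : Subsingleton (Ext.{w} S.X₂ Y n)) (h₃ : Subsingleton (Ext.{w} S.X₃ Y (1 + n))) :
    Subsingleton (Ext.{w} S.X₁ Y n) := by
  refine subsingleton_of_forall_eq 0 (fun x => ?_)
  obtain ⟨y, rfl⟩ := Ext.contravariant_sequence_exact₁ hS Y x rfl (Subsingleton.elim _ _)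
  rw [Subsingleton.elim y 0, Ext.comp_zero]

lemma subsingleton_ext_middle {S : ShortComplex 𝒜} (hS : S.ShortExact) {Y : 𝒜} {n : ℕ}
    (h₁ : Subsingleton (Ext.{w} S.X₁ Y n)) (h₃ : Subsingleton (Ext.{w} S.X₃ Y n)) :
    Subsingleton (Ext.{w} S.X₂ Y n) := by
  refine subsingleton_of_forall_eq 0 (fun x => ?_)
  obtain ⟨y, rfl⟩ := Ext.contravariant_sequence_exact₂ hS Y x (Subsingleton.elim _ _)
  rw [Subsingleton.elim y 0, Ext.comp_zero]

variable {𝓔 𝓐 𝓑 𝓒 𝓓 : ObjectProperty 𝒜}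

/-- An object of `𝓐` is its own right approximation. -/
noncomputable def RightApprox.self {X : 𝒜} (hX : 𝓐 X) (h₀ : 𝓑 0) : RightApprox 𝓐 𝓑 X where
  B := 0
  A := X
  ι := 0
  p := 𝟙 X
  w := zero_comp
  exact :=
    { exact := (ShortComplex.exact_iff_mono _ rfl).2 (by dsimp; infer_instance)
      mono_f := ⟨fun _ _ _ => (isZero_zero 𝒜).eq_of_tgt _ _⟩
      epi_g := by dsimp; infer_instance }
  hA := hX
  hB := h₀

/-- An object of `𝓑` is its own left approximation. -/
noncomputable def LeftApprox.self {X : 𝒜} (hX : 𝓑 X) (h₀ : 𝓐 0) : LeftApprox 𝓐 𝓑 X where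
  B := X
  A := 0
  ι := 𝟙 X
  p := 0
  w := comp_zero
  exact :=
    { exact := (ShortComplex.exact_iff_epi _ rfl).2 (by dsimp; infer_instance)
      mono_f := by dsimp; infer_instance
      epi_g := ⟨fun _ _ _ => (isZero_zero 𝒜).eq_of_src _ _⟩ }
  hA := h₀
  hB := hX

namespace Setting

variable (h : Setting.{w} 𝓔 𝓐 𝓑 𝓒 𝓓)

include h

/-- The class `𝓐` is closed under retracts in `𝓔`. -/
lemma mem_A_of_retract {X Q : 𝒜} (hX : 𝓔 X) (hQ : 𝓐 Q) (a : X ⟶ Q) (b : Q ⟶ X)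
    (e : a ≫ b = 𝟙 X) : 𝓐 X :=
  (h.cotorsion.left_iff X).2 ⟨hX, fun _ hY => subsingleton_ext_of_retract a b e (h.orth hQ hY)⟩

/-- The class `𝓐` is closed under kernels of admissible epimorphisms of `𝓔`: this uses that the
cotorsion pair is hereditary. -/
lemma mem_A_of_shortExact_left {S : ShortComplex 𝒜} (hS : S.ShortExact) (h₁ : 𝓔 S.X₁)
    (h₂ : 𝓐 S.X₂) (h₃ : 𝓐 S.X₃) : 𝓐 S.X₁ :=
  (h.cotorsion.left_iff _).2 ⟨h₁, fun Y hY => subsingleton_ext_left hS (h.orth h₂ hY)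
    (h.hereditary (1 + 1) _ _ (by omega) h₃ hY)⟩

/-- The class `𝓐` is closed under extensions. -/
lemma mem_A_of_shortExact_middle {S : ShortComplex 𝒜} (hS : S.ShortExact) (h₁ : 𝓐 S.X₁)
    (h₃ : 𝓐 S.X₃) : 𝓐 S.X₂ :=
  have := h.ext
  (h.cotorsion.left_iff _).2 ⟨𝓔.prop_X₂_of_shortExact hS (h.A_le_E _ h₁) (h.A_le_E _ h₃),
    fun _ hY => subsingleton_ext_middle hS (h.orth h₁ hY) (h.orth h₃ hY)⟩

end Setting

end Frob

/-! ### The adjunctions and the localization sequence -/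

namespace Frob

variable {𝒜 : Type u} [Category.{v} 𝒜] [Abelian 𝒜] [HasExt.{w} 𝒜]

namespace Setting

variable {𝓔 𝓐 𝓑 𝓒 𝓓 : ObjectProperty 𝒜}
variable [IsFrobenius (𝓐 ⊓ 𝓓)] [IsFrobenius (𝓒 ⊓ 𝓓)] [IsFrobenius (𝓒 ⊓ 𝓑)]
variable (h : Setting.{w} 𝓔 𝓐 𝓑 𝓒 𝓓)

open Stable

instance : h.iLowerStar.Full := inferInstanceAs (incl _ _).Full

instance : h.iLowerStar.Faithful :=
  incl_faithful _ _ (fun X hX => (h.proj_AD X).2 ((h.proj_CD X).1 hX))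

noncomputable instance : h.iLowerStar.CommShift ℤ := inferInstanceAs ((incl _ _).CommShift ℤ)

instance : h.iLowerStar.IsTriangulated := inferInstanceAs (incl _ _).IsTriangulated

instance : h.jLowerStar.Full := inferInstanceAs (incl _ _).Full

instance : h.jLowerStar.Faithful :=
  incl_faithful _ _ (fun X hX => (h.proj_CB X).2 ((h.proj_CD X).1 hX))

noncomputable instance : h.jLowerStar.CommShift ℤ := inferInstanceAs ((incl _ _).CommShift ℤ)

instance : h.jLowerStar.IsTriangulated := inferInstanceAs (incl _ _).IsTriangulated

lemma rightApproxMap_naturality {M M' : Stable (𝓒 ⊓ 𝓓)} (f : M ⟶ M') :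
    h.iLowerStar.map (h.iUpperShriek.map f) ≫ h.rightApproxMap M' = h.rightApproxMap M ≫ f := by
  have e := (h.exists_right (h.rightApprox M) (h.rightApprox M') (rep f)).choose_spec
  refine Eq.trans (congrArg (cls (X := h.iLowerStar.obj (h.iUpperShriek.obj M)) (Y := M')) e) ?_
  exact congrArg (h.rightApproxMap M ≫ ·) (cls_rep f)

lemma leftApproxMap_naturality {M M' : Stable (𝓒 ⊓ 𝓓)} (f : M ⟶ M') :
    f ≫ h.leftApproxMap M' = h.leftApproxMap M ≫ h.jLowerStar.map (h.jUpperStar.map f) := by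
  have e := (h.exists_left (h.leftApprox M) (h.leftApprox M') (rep f)).choose_spec
  refine Eq.trans ?_ (congrArg (cls (X := M)
    (Y := h.jLowerStar.obj (h.jUpperStar.obj M'))) e).symm
  exact (congrArg (· ≫ h.leftApproxMap M') (cls_rep f)).symm

/-- Morphisms from `N` in `𝓐 ∩ 𝓓` factor uniquely through the right approximation, because `N` is
its own right approximation. -/
lemma bijective_comp_rightApproxMap (N : Stable (𝓐 ⊓ 𝓓)) (M : Stable (𝓒 ⊓ 𝓓)) :
    Function.Bijective (fun g : N ⟶ h.iUpperShriek.obj M =>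
      h.iLowerStar.map g ≫ h.rightApproxMap M) := by
  let S : RightApprox 𝓐 𝓑 N.obj := .self N.mem.1
    (prop_of_isZero (𝓒 ⊓ 𝓑) (isZero_zero 𝒜)).2
  constructor
  · intro g g' e
    obtain ⟨g, rfl⟩ := cls_surj g
    obtain ⟨g', rfl⟩ := cls_surj g'
    exact h.right_congr (M := h.iLowerStar.obj N) S (h.rightApprox M)
      (f := g ≫ (h.rightApprox M).p) (f' := g' ≫ (h.rightApprox M).p) e
      (id_comp _).symm (id_comp _).symm
  · intro f
    obtain ⟨f, rfl⟩ := cls_surj f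
    obtain ⟨g, hg⟩ := h.exists_right S (h.rightApprox M) f
    refine ⟨cls g, ?_⟩
    exact congrArg (cls (X := h.iLowerStar.obj N) (Y := M)) (hg.trans (id_comp f))

/-- Morphisms to `N` in `𝓒 ∩ 𝓑` factor uniquely through the left approximation, because `N` is
its own left approximation. -/
lemma bijective_leftApproxMap_comp (M : Stable (𝓒 ⊓ 𝓓)) (N : Stable (𝓒 ⊓ 𝓑)) :
    Function.Bijective (fun g : h.jUpperStar.obj M ⟶ N =>
      h.leftApproxMap M ≫ h.jLowerStar.map g) := by
  let S : LeftApprox 𝓐 𝓑 N.obj := .self N.mem.2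
    (prop_of_isZero (𝓐 ⊓ 𝓓) (isZero_zero 𝒜)).1
  constructor
  · intro g g' e
    obtain ⟨g, rfl⟩ := cls_surj g
    obtain ⟨g', rfl⟩ := cls_surj g'
    exact h.left_congr (M' := h.jLowerStar.obj N) (h.leftApprox M) S
      (f := (h.leftApprox M).ι ≫ g) (f' := (h.leftApprox M).ι ≫ g') e
      (comp_id _).symm (comp_id _).symm
  · intro f
    obtain ⟨f, rfl⟩ := cls_surj f
    obtain ⟨g, hg⟩ := h.exists_left (h.leftApprox M) S f
    refine ⟨cls g, ?_⟩
    exact congrArg (cls (X := M) (Y := h.jLowerStar.obj N)) (hg.trans (comp_id f))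

/-- The adjunction `i_* ⊣ i^!` whose counit is given by the right approximations. -/
noncomputable def iAdj : h.iLowerStar ⊣ h.iUpperShriek :=
  .ofCounit h.rightApproxMap h.rightApproxMap_naturality h.bijective_comp_rightApproxMap

/-- The adjunction `j^* ⊣ j_*` whose unit is given by the left approximations. -/
noncomputable def jAdj : h.jUpperStar ⊣ h.jLowerStar :=
  .ofUnit h.leftApproxMap h.leftApproxMap_naturality h.bijective_leftApproxMap_comp

noncomputable instance : h.iUpperShriek.CommShift ℤ := h.iAdj.rightAdjointCommShift ℤ

noncomputable instance : h.jUpperStar.CommShift ℤ := h.jAdj.leftAdjointCommShift ℤ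

instance : h.iAdj.CommShift ℤ := h.iAdj.commShift_of_leftAdjoint ℤ

instance : h.jAdj.CommShift ℤ := h.jAdj.commShift_of_rightAdjoint ℤ

instance : h.iAdj.IsTriangulated := .mk' _

instance : h.jAdj.IsTriangulated := .mk'' _

/-- If the middle term of the left approximation of `M` is stably zero, it lies in `𝓐`, hence so
does the kernel `M`. Conversely, the middle term is an extension of objects of `𝓐` if `M` lies
in `𝓐`. -/
lemma isZero_jUpperStar_obj_iff (M : Stable (𝓒 ⊓ 𝓓)) :
    IsZero (h.jUpperStar.obj M) ↔ h.iLowerStar.essImage M := by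
  constructor
  · intro hM
    obtain ⟨Q, hQ, a, b, e⟩ := (isZero_iff_isProj_factor _).1 hM
    have hB : 𝓐 (h.leftApprox M).B := h.mem_A_of_retract (h.B_le_E _ (h.leftApprox M).hB)
      ((h.proj_CB Q).1 hQ).1 a b e
    have hA := h.mem_A_of_shortExact_left (h.leftApprox M).exact (h.C_le_E _ M.mem.1) hB
      (h.leftApprox M).hA
    exact ⟨⟨M.obj, hA, M.mem.2⟩, ⟨Iso.refl _⟩⟩
  · rintro ⟨N, ⟨e⟩⟩
    refine IsZero.of_iso ?_ (h.jUpperStar.mapIso e.symm)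
    refine isZero_of_isProj ((h.proj_CB _).2 ⟨?_, (h.leftApprox (h.iLowerStar.obj N)).hB⟩)
    exact h.mem_A_of_shortExact_middle (h.leftApprox (h.iLowerStar.obj N)).exact N.mem.1
      (h.leftApprox (h.iLowerStar.obj N)).hA

theorem isLocalizationSequence : IsLocalizationSequence h.iAdj h.jAdj where
  isTriangulated_left := inferInstance
  isTriangulated_right := inferInstance
  isIso_unit := inferInstance
  isIso_counit := inferInstance
  kernel := h.isZero_jUpperStar_obj_iff

end Setting

end Frob

theorem mainTheorem7 {R : Type u} [Ring R] [Small.{v} R]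
    (𝓔 𝓐 𝓑 𝓒 𝓓 : ObjectProperty (ModuleCat.{v} R))
    [Frob.IsFrobenius (𝓐 ⊓ 𝓓)] [Frob.IsFrobenius (𝓒 ⊓ 𝓓)] [Frob.IsFrobenius (𝓒 ⊓ 𝓑)]
    (h : Frob.Setting.{v} 𝓔 𝓐 𝓑 𝓒 𝓓) :
    ∃ (_ : h.iLowerStar.CommShift ℤ) (_ : h.iUpperShriek.CommShift ℤ)
      (_ : h.jUpperStar.CommShift ℤ) (_ : h.jLowerStar.CommShift ℤ)
      (adj₁ : h.iLowerStar ⊣ h.iUpperShriek) (adj₂ : h.jUpperStar ⊣ h.jLowerStar),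
      (∀ M, adj₁.counit.app M = h.rightApproxMap M) ∧
      (∀ M, adj₂.unit.app M = h.leftApproxMap M) ∧
      adj₁.IsTriangulated ∧ adj₂.IsTriangulated ∧
      IsLocalizationSequence adj₁ adj₂ ∧
      ∃ (_ : h.iLowerStar.essImage.IsTriangulated)
        (Φ : h.iLowerStar.essImage.trW.Localization ⥤ Frob.Stable (𝓒 ⊓ 𝓑))
        (_ : Φ.CommShift ℤ) (e : h.iLowerStar.essImage.trW.Q ⋙ Φ ≅ h.jUpperStar),
        Φ.IsTriangulated ∧ Φ.IsEquivalence ∧ NatTrans.CommShift e.hom ℤ :=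
  ⟨inferInstance, inferInstance, inferInstance, inferInstance, h.iAdj, h.jAdj,
    Adjunction.ofCounit_counit_app _ _ _, Adjunction.ofUnit_unit_app _ _ _,
    inferInstance, inferInstance, h.isLocalizationSequence, inferInstance,
    exists_verdierQuotient_equivalence h.jUpperStar h.iLowerStar.essImage
      h.isZero_jUpperStar_obj_iff h.jAdj⟩
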